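/- **Setting.** Let $d\ge 1$, $n=2^d$. A *tree-structured Boolean circuit* $C$ of depth $d$ is a full binary tree with an arbitrary gate $\gamma_{i,j}:\{\pm1\}^2\to\{\pm1\}$ at each inner node $(i,j)$, $0\le i<d$, $1\le j\le 2^i$ ($(0,1)$ is the output node); the nodes of level $d$ are the input bits $x_1,\dots,x_n$, and the inputs of gate $(i,j)$ are the nodes $(i+1,2j-1),(i+1,2j)$. Write $z_{i,j}(x)$ for the value of node $(i,j)$ on input $x\in\{\pm1\}^n$, $h_C(x)=z_{0,1}(x)$, and $\Gamma_i:\{\pm1\}^{2^{i+1}}\to\{\pm1\}^{2^i}$ for the map computed by the gates of level $i$. For a distribution $\mathcal D$ of $(x,y)\in\{\pm1\}^n\times\{\pm1\}$ put $c_{i,j}=\mathbb E_{\mathcal D}[z_{i,j}(x)\,y]$; the influence of node $(i+1,j)$ is $\mathcal I_{i+1,j}=\Pr_{z}[\Gamma_i(z)\ne\Gamma_i(z\oplus e_j)]$, with $z$ uniform on $\{\pm1\}^{2^{i+1}}$ and $z\oplus e_j$ equal to $z$ with the $j$-th coordinate negated. **Network and algorithm.** Let $\sigma(t)=\max(t,0)$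 and $\phi(t)=\max(\min(t,1),-1)$. A neural gate of width $k$ is $g_{w,v}(x)=\phi\big(\sum_{l=1}^k v_l\,\sigma(\langle w_l,x\rangle)\big)$, $x\in\mathbb R^2$, $w_l\in\mathbb R^2$, $v_l\in\{\pm1\}$. For each level $0\le i<d$ the block $B_i:\mathbb R^{2^{i+1}}\to\mathbb R^{2^i}$ applies $2^i$ neural gates (each with its own $w,v$) to the consecutive pairs of coordinates. Let $P$ denote the average of coordinates. For $\lambda\in\mathbb R$ and a sample $S=((x_1,y_1),\dots,(x_m,y_m))$ let $L_S(f)=\frac1m\sum_{s}\big(\max(1-y_sf(x_s),0)+\lambda\,|1+f(x_s)|\big)$. *Layerwise gradient descent* with learning rate $\eta$ and $T$ steps per layer starts with $\mathcal N=\mathrm{id}$; for $i=d-1,\dots,0$ it performs $T$ gradient steps $W\leftarrow W-\eta\,\partial_W L_S(P\circ B_i\circ\mathcal N)$ on the first-layer weights $W$ of $B_i$ only, from their initial value and with the $v$'s fixed, and then replaces $\mathcal N$ by $B_i\circ\mathcal N$. The gradient is computed by the chain rule, with subgradient $0$ at the kinks of $\sigma$, $\phi$, the hinge and the absolute value. The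 final $\mathcal N_0:\{\pm1\}^n\to\mathbb R$ is returned. **Initialization.** All neurons of the network are independent; for each of them $v$ is uniform on $\{\pm1\}$ and independent of $w\in\mathbb R^2$, and the law of $w$ (which may differ between neurons) satisfies $\|w\|_\infty\le\frac1{4\sqrt2k}$ almost surely and $\Pr[\langle w,p\rangle>0]=\frac12$ for each $p\in\{\pm1\}^2$ (for instance, $w$ uniform on the square $\|w\|_\infty\le\frac1{4\sqrt2k}$). **Theorem.** Let $\delta,\Delta,\epsilon\in(0,\frac12)$, $d\ge1$, $n=2^d$, let $k\ge\log^{-1}(\frac43)\log(\frac{2nd}{\delta})$ be an integer, $0<\eta\le\frac1{16\sqrt2k}$. Let $C$ be a tree-structured Boolean circuit of depth $d$, and let $\mathcal D$ be a distribution on $\{\pm1\}^n\times\{\pm1\}$ with $\Pr_{\mathcal D}[h_C(x)\ne y]=0$ and $0\le\mathbb E_{\mathcal D}[y]<1$, such that 1. for all $1\le i\le d$, $1\le j\le2^i$: either $\mathcal I_{i,j}=0$ and $z_{i,j}$ is independent of $y$, or $|c_{i,j}|>\mathbb E_{\mathcal D}[y]+\Delta$; 2. for all $0\le i<d$, $1\le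 j\le 2^i$: the pair $(z_{i+1,2j-1},z_{i+1,2j})$ is conditionally independent of $y$ given $z_{i,j}$; 3. for all $0\le i<d$, $1\le j\le 2^i$ and $p\in\{\pm1\}^2$: if $\Pr_{\mathcal D}[(z_{i+1,2j-1},z_{i+1,2j})=p]>0$, then this probability is at least $\epsilon$. Let $\lambda=\mathbb E_{\mathcal D}[y]+\frac\Delta4$, let $S$ be an i.i.d. sample from $\mathcal D$ of size $m>\frac{2^{11}}{\epsilon^2\Delta^2}\log(\frac{8nd}\delta)$, independent of the initialization, and let $T>\frac{6n}{\sqrt2\,\eta\epsilon\Delta}$ be an integer. Then with probability at least $1-\delta$ over $S$ and the initialization, layerwise gradient descent on $S$ with $T$ steps per layer returns $\mathcal N_0$ with $\Pr_{(x,y)\sim\mathcal D}[\mathcal N_0(x)\ne y]=0$. -/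

import Mathlib

namespace TreeCircuit

open MeasureTheory ProbabilityTheory

/-! ### Tree-structured Boolean circuits

The two-element set `{±1}` is `ℤˣ`.  Levels are numbered by their depth in the tree: level `i` has
`2 ^ i` nodes, level `0` is the output node and level `d` consists of the `n = 2 ^ d` input bits. -/

/-- The real number `±1` represented by an element of `{±1} = ℤˣ`. -/
def toReal (s : ℤˣ) : ℝ := ((s : ℤ) : ℝ)

/-- The `j`-th pair of consecutive coordinates of a vector with `2 ^ (i + 1)` coordinates
(numbered from `0`): the inputs of the `j`-th gate of level `i`. -/
def pairAt {α : Type*} {i : ℕ} (z : Fin (2 ^ (i + 1)) → α) (j : Fin (2 ^ i)) : Fin 2 → α :=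
  fun a => z ⟨2 * (j : ℕ) + (a : ℕ), by
    have hj := j.isLt
    have ha := a.isLt
    rw [pow_succ]
    omega⟩

/-- A full binary tree of depth `d` with an arbitrary Boolean gate `{±1}² → {±1}` at every inner
node `(i, j)`, where `i < d` is the level and `j < 2 ^ i` the position in the level. -/
abbrev Circuit (d : ℕ) : Type :=
  (i : Fin d) → Fin (2 ^ (i : ℕ)) → (Fin 2 → ℤˣ) → ℤˣ

namespace Circuit

variable {d : ℕ}

/-- The function computed by the gates of level `i`, from the values at the nodes of
level `i + 1` to the values at the nodes of level `i`. -/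
def layer (C : Circuit d) (i : Fin d) (z : Fin (2 ^ ((i : ℕ) + 1)) → ℤˣ) :
    Fin (2 ^ (i : ℕ)) → ℤˣ :=
  fun j => C i j (pairAt z j)

/-- The values at the nodes of level `i`, where `r` is the number of gate levels below `i`. -/
def levelAux (C : Circuit d) (x : Fin (2 ^ d) → ℤˣ) :
    (r i : ℕ) → i + r = d → Fin (2 ^ i) → ℤˣ
  | 0, i, h => fun j => x (Fin.cast (by rw [← h, Nat.add_zero]) j)
  | r + 1, i, h => C.layer ⟨i, by omega⟩ (levelAux C x r (i + 1) (by omega))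

/-- The values at the nodes of level `i` when the circuit reads the input `x`. -/
def level (C : Circuit d) (i : ℕ) (hi : i ≤ d) (x : Fin (2 ^ d) → ℤˣ) : Fin (2 ^ i) → ℤˣ :=
  C.levelAux x (d - i) i (by omega)

/-- The Boolean function computed by the circuit. -/
def eval (C : Circuit d) (x : Fin (2 ^ d) → ℤˣ) : ℤˣ :=
  C.level 0 (Nat.zero_le d) x 0

/-- The influence of node `j` of level `i + 1`: the probability, over a uniformly random vector
`z ∈ {±1}^(2^(i+1))` of node values, that flipping `z_j` changes the output of the level above. -/
noncomputable def influence (C : Circuit d) (i : Fin d) (j : Fin (2 ^ ((i : ℕ) + 1))) : ℝ :=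
  ((Finset.univ.filter fun z : Fin (2 ^ ((i : ℕ) + 1)) → ℤˣ =>
      C.layer i z ≠ C.layer i (Function.update z j (-z j))).card : ℝ) /
    (Fintype.card (Fin (2 ^ ((i : ℕ) + 1)) → ℤˣ) : ℝ)

end Circuit

/-! ### Distributions of labelled examples -/

/-- Labelled examples `(x, y) ∈ {±1}^n × {±1}`, `n = 2 ^ d`. -/
abbrev Example (d : ℕ) : Type := (Fin (2 ^ d) → ℤˣ) × ℤˣ

variable {d : ℕ}

/-- The expected label `E[y]`. -/
noncomputable def meanLabel (D : Measure (Example d)) : ℝ :=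
  ∫ e, toReal e.2 ∂D

/-- The correlation `E[z_j y]` between the value `z_j` of node `j` of level `i` and the label. -/
noncomputable def correlation (C : Circuit d) (D : Measure (Example d)) (i : ℕ) (hi : i ≤ d)
    (j : Fin (2 ^ i)) : ℝ :=
  ∫ e, toReal (C.level i hi e.1 j) * toReal e.2 ∂D

/-- Every node (other than the output node) either has zero influence and a value that is
independent of the label, or its correlation with the label exceeds `E[y] + Δ` in absolute value. -/
def CorrelationProperty (C : Circuit d) (D : Measure (Example d)) (Δ : ℝ) : Prop :=
  ∀ (i : Fin d) (j : Fin (2 ^ ((i : ℕ) + 1))),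
    (C.influence i j = 0 ∧
      IndepFun (fun e : Example d => C.level ((i : ℕ) + 1) i.isLt e.1 j) (fun e => e.2) D) ∨
    meanLabel D + Δ < |correlation C D ((i : ℕ) + 1) i.isLt j|

/-- Given the output of a gate, its input pattern is conditionally independent of the label. -/
def CondIndepProperty (C : Circuit d) (D : Measure (Example d)) : Prop :=
  ∀ (i : Fin d) (j : Fin (2 ^ (i : ℕ))) (s : ℤˣ) (p : Fin 2 → ℤˣ) (y : ℤˣ),
    let pair : Example d → Fin 2 → ℤˣ := fun e => pairAt (C.level ((i : ℕ) + 1) i.isLt e.1) j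
    let given : Measure (Example d) := ProbabilityTheory.cond D {e | C i j (pair e) = s}
    given {e | pair e = p ∧ e.2 = y} = given {e | pair e = p} * given {e | e.2 = y}

/-- Every input pattern of a gate that has positive probability has probability at least `ε`. -/
def PatternProperty (C : Circuit d) (D : Measure (Example d)) (ε : ℝ) : Prop :=
  ∀ (i : Fin d) (j : Fin (2 ^ (i : ℕ))) (p : Fin 2 → ℤˣ),
    0 < D.real {e | pairAt (C.level ((i : ℕ) + 1) i.isLt e.1) j = p} →
    ε ≤ D.real {e | pairAt (C.level ((i : ℕ) + 1) i.isLt e.1) j = p}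

/-! ### The network -/

/-- The ReLU activation. -/
noncomputable def relu (x : ℝ) : ℝ := max x 0

/-- The hard-tanh activation. -/
noncomputable def hardTanh (x : ℝ) : ℝ := max (min x 1) (-1)

/-- The output of a neural gate before the hard-tanh activation. -/
noncomputable def preActivation {k : ℕ} (w : Fin k → Fin 2 → ℝ) (v : Fin k → ℤˣ)
    (x : Fin 2 → ℝ) : ℝ :=
  ∑ l, toReal (v l) * relu (∑ a, w l a * x a)

/-- The neural gate of width `k` with first-layer weights `w` and second-layer weights `v`. -/
noncomputable def neuralGate {k : ℕ} (w : Fin k → Fin 2 → ℝ) (v : Fin k → ℤˣ)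
    (x : Fin 2 → ℝ) : ℝ :=
  hardTanh (preActivation w v x)

/-- First-layer weights of the `2 ^ i` neural gates of width `k` of level `i`. -/
abbrev Weights (i k : ℕ) : Type := Fin (2 ^ i) → Fin k → Fin 2 → ℝ

/-- Second-layer weights of the `2 ^ i` neural gates of width `k` of level `i`. -/
abbrev Signs (i k : ℕ) : Type := Fin (2 ^ i) → Fin k → ℤˣ

/-- The block of neural gates of level `i`. -/
noncomputable def block {i k : ℕ} (W : Weights i k) (V : Signs i k)
    (z : Fin (2 ^ (i + 1)) → ℝ) : Fin (2 ^ i) → ℝ :=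
  fun j => neuralGate (W j) (V j) (pairAt z j)

/-- Average pooling. -/
noncomputable def avgPool {i : ℕ} (z : Fin (2 ^ i) → ℝ) : ℝ := (∑ j, z j) / 2 ^ i

/-! ### The loss, its gradient, and layerwise gradient descent -/

/-- The hinge loss of the prediction `u` for the label `y`, plus the regularization `lam * |1 + u|`. -/
noncomputable def loss (lam u : ℝ) (y : ℤˣ) : ℝ :=
  max (1 - toReal y * u) 0 + lam * |1 + u|

/-- The empirical loss of the pooled output of a block on top of the fixed network `N`. -/
noncomputable def layerLoss {i k m : ℕ} (S : Fin m → Example d) (lam : ℝ)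
    (N : (Fin (2 ^ d) → ℤˣ) → Fin (2 ^ (i + 1)) → ℝ) (V : Signs i k) (W : Weights i k) : ℝ :=
  (∑ s, loss lam (avgPool (block W V (N (S s).1))) (S s).2) / m

/-- The derivative of `relu`, with subgradient `0` at the kink. -/
noncomputable def reluDeriv (x : ℝ) : ℝ := if 0 < x then 1 else 0

/-- The derivative of `hardTanh`, with subgradient `0` at the kinks. -/
noncomputable def hardTanhDeriv (x : ℝ) : ℝ := if -1 < x ∧ x < 1 then 1 else 0

/-- The derivative of `loss` in the prediction, with subgradient `0` of either term at its kink. -/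
noncomputable def lossDeriv (lam u : ℝ) (y : ℤˣ) : ℝ :=
  (if 0 < 1 - toReal y * u then -toReal y else 0) + lam * Real.sign (1 + u)

/-- The (sub)gradient of `layerLoss` with respect to the weights `W`, by the chain rule. -/
noncomputable def layerGrad {i k m : ℕ} (S : Fin m → Example d) (lam : ℝ)
    (N : (Fin (2 ^ d) → ℤˣ) → Fin (2 ^ (i + 1)) → ℝ) (V : Signs i k) (W : Weights i k) :
    Weights i k :=
  fun j l a =>
    (∑ s,
      let z : Fin (2 ^ (i + 1)) → ℝ := N (S s).1
      lossDeriv lam (avgPool (block W V z)) (S s).2 *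
        (hardTanhDeriv (preActivation (W j) (V j) (pairAt z j)) *
          (toReal (V j l) * (reluDeriv (∑ b, W j l b * pairAt z j b) * pairAt z j a)) / 2 ^ i)) / m

theorem hasDerivAt_relu {x : ℝ} (hx : x ≠ 0) : HasDerivAt relu (reluDeriv x) x := by
  rcases lt_or_gt_of_ne hx with h | h
  · rw [reluDeriv, if_neg (not_lt.mpr h.le)]
    refine (hasDerivAt_const x (0 : ℝ)).congr_of_eventuallyEq ?_
    filter_upwards [Iio_mem_nhds h] with t ht
    exact max_eq_right (le_of_lt ht)
  · rw [reluDeriv, if_pos h]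
    refine (hasDerivAt_id x).congr_of_eventuallyEq ?_
    filter_upwards [Ioi_mem_nhds h] with t ht
    exact max_eq_left (le_of_lt ht)

theorem hasDerivAt_hardTanh {x : ℝ} (h1 : x ≠ 1) (h2 : x ≠ -1) :
    HasDerivAt hardTanh (hardTanhDeriv x) x := by
  rcases lt_or_gt_of_ne h2 with h | h
  · rw [hardTanhDeriv, if_neg (fun hh => absurd hh.1 (not_lt.mpr h.le))]
    refine (hasDerivAt_const x (-1 : ℝ)).congr_of_eventuallyEq ?_
    filter_upwards [Iio_mem_nhds h] with t ht
    exact max_eq_right ((min_le_left _ _).trans (le_of_lt ht))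
  · rcases lt_or_gt_of_ne h1 with h' | h'
    · rw [hardTanhDeriv, if_pos ⟨h, h'⟩]
      refine (hasDerivAt_id x).congr_of_eventuallyEq ?_
      filter_upwards [Ioo_mem_nhds h h'] with t ht
      simp only [hardTanh, id]
      rw [min_eq_left ht.2.le, max_eq_left ht.1.le]
    · rw [hardTanhDeriv, if_neg (fun hh => absurd hh.2 (not_lt.mpr h'.le))]
      refine (hasDerivAt_const x (1 : ℝ)).congr_of_eventuallyEq ?_
      filter_upwards [Ioi_mem_nhds h'] with t ht
      simp only [hardTanh]
      rw [min_eq_right (le_of_lt ht), max_eq_left (by norm_num)]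

theorem hasDerivAt_loss {lam u : ℝ} {y : ℤˣ} (h1 : 1 - toReal y * u ≠ 0) (h2 : 1 + u ≠ 0) :
    HasDerivAt (fun t => loss lam t y) (lossDeriv lam u y) u := by
  have e1 : HasDerivAt (fun t => max (1 - toReal y * t) 0)
      (if 0 < 1 - toReal y * u then -toReal y else 0) u := by
    have hin : HasDerivAt (fun t => 1 - toReal y * t) (-toReal y) u := by
      simpa using ((hasDerivAt_id u).const_mul (toReal y)).const_sub 1
    have := (hasDerivAt_relu h1).comp u hin
    refine this.congr_deriv ?_
    simp only [reluDeriv]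
    split_ifs <;> simp
  have e2 : HasDerivAt (fun t : ℝ => |1 + t|) (Real.sign (1 + u)) u := by
    have hin : HasDerivAt (fun t : ℝ => 1 + t) 1 u := (hasDerivAt_id u).const_add 1
    rcases lt_or_gt_of_ne h2 with h | h
    · rw [Real.sign_of_neg h]
      simpa [Function.comp_def] using (hasDerivAt_abs_neg h).comp u hin
    · rw [Real.sign_of_pos h]
      simpa [Function.comp_def] using (hasDerivAt_abs_pos h).comp u hin
  exact e1.add (e2.const_mul lam)

/-- Away from the kinks, `layerGrad` is the vector of the partial derivatives of `layerLoss`. -/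
theorem hasDerivAt_layerLoss {i k m : ℕ} (S : Fin m → Example d) (lam : ℝ)
    (N : (Fin (2 ^ d) → ℤˣ) → Fin (2 ^ (i + 1)) → ℝ) (V : Signs i k) (W : Weights i k)
    (j : Fin (2 ^ i)) (l : Fin k) (a : Fin 2)
    (hrelu : ∀ s, ∑ b, W j l b * pairAt (N (S s).1) j b ≠ 0)
    (htanh : ∀ s, preActivation (W j) (V j) (pairAt (N (S s).1) j) ≠ 1 ∧
      preActivation (W j) (V j) (pairAt (N (S s).1) j) ≠ -1)
    (hloss : ∀ s, 1 - toReal (S s).2 * avgPool (block W V (N (S s).1)) ≠ 0 ∧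
      1 + avgPool (block W V (N (S s).1)) ≠ 0) :
    HasDerivAt
      (fun t => layerLoss S lam N V
        (Function.update W j (Function.update (W j) l (Function.update (W j l) a t))))
      (layerGrad S lam N V W j l a) (W j l a) := by
  have hself : Function.update W j
      (Function.update (W j) l (Function.update (W j l) a (W j l a))) = W := by simp
  unfold layerLoss layerGrad
  refine HasDerivAt.div_const (HasDerivAt.fun_sum fun s _ => ?_) _
  set z : Fin (2 ^ (i + 1)) → ℝ := N (S s).1 with hz
  set x : Fin 2 → ℝ := pairAt z j with hx
  -- the linear form of neuron `l`
  have hlin : HasDerivAt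
      (fun t => ∑ b, Function.update (W j l) a t b * x b) (x a) (W j l a) := by
    have : ∀ b, HasDerivAt (fun t => Function.update (W j l) a t b * x b)
        (if b = a then x a else 0) (W j l a) := by
      intro b
      by_cases hb : b = a
      · subst hb
        simpa using (hasDerivAt_id (W j l b)).mul_const (x b)
      · simpa [hb] using hasDerivAt_const (W j l a) (W j l b * x b)
    simpa using HasDerivAt.fun_sum (u := Finset.univ) fun b _ => this b
  have hpre : HasDerivAt
      (fun t => preActivation (Function.update (W j) l (Function.update (W j l) a t)) (V j) x)
      (toReal (V j l) * (reluDeriv (∑ b, W j l b * x b) * x a)) (W j l a) := by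
    unfold preActivation
    have : ∀ l', HasDerivAt
        (fun t => toReal (V j l') *
          relu (∑ b, Function.update (W j) l (Function.update (W j l) a t) l' b * x b))
        (if l' = l then toReal (V j l) * (reluDeriv (∑ b, W j l b * x b) * x a) else 0)
        (W j l a) := by
      intro l'
      by_cases hl : l' = l
      · subst hl
        simp only [Function.update_self, if_true]
        have hr : HasDerivAt relu (reluDeriv (∑ b, W j l' b * x b))
            (∑ b, Function.update (W j l') a (W j l' a) b * x b) := by
          rw [Function.update_eq_self]
          exact hasDerivAt_relu (hrelu s)
        exact (hr.comp (W j l' a) hlin).const_mul _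
      · simp only [Function.update_of_ne hl, if_neg hl]
        exact hasDerivAt_const _ _
    simpa using HasDerivAt.fun_sum (u := Finset.univ) fun l' _ => this l'
  have hpool : HasDerivAt
      (fun t => avgPool (block
        (Function.update W j (Function.update (W j) l (Function.update (W j l) a t))) V z))
      (hardTanhDeriv (preActivation (W j) (V j) x) *
        (toReal (V j l) * (reluDeriv (∑ b, W j l b * x b) * x a)) / 2 ^ i) (W j l a) := by
    unfold avgPool
    refine HasDerivAt.div_const ?_ _
    have : ∀ j', HasDerivAt
        (fun t => block
          (Function.update W j (Function.update (W j) l (Function.update (W j l) a t))) V z j')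
        (if j' = j then hardTanhDeriv (preActivation (W j) (V j) x) *
          (toReal (V j l) * (reluDeriv (∑ b, W j l b * x b) * x a)) else 0) (W j l a) := by
      intro j'
      unfold block neuralGate
      by_cases hj : j' = j
      · subst hj
        simp only [Function.update_self, if_true]
        have hr : HasDerivAt hardTanh (hardTanhDeriv (preActivation (W j') (V j') x))
            (preActivation (Function.update (W j') l (Function.update (W j' l) a (W j' l a)))
              (V j') x) := by
          rw [Function.update_eq_self, Function.update_eq_self]
          exact hasDerivAt_hardTanh (htanh s).1 (htanh s).2
        exact hr.comp (W j' l a) hpre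
      · simp only [Function.update_of_ne hj, if_neg hj]
        exact hasDerivAt_const _ _
    simpa using HasDerivAt.fun_sum (u := Finset.univ) fun j' _ => this j'
  have hl : HasDerivAt (fun u => loss lam u (S s).2)
      (lossDeriv lam (avgPool (block W V z)) (S s).2)
      (avgPool (block (Function.update W j
        (Function.update (W j) l (Function.update (W j l) a (W j l a)))) V z)) := by
    rw [hself]
    exact hasDerivAt_loss (hloss s).1 (hloss s).2
  exact hl.comp (W j l a) hpool

/-- `T` steps of gradient descent with learning rate `η` on the weights of one block. -/
noncomputable def trainLayer {i k m : ℕ} (S : Fin m → Example d) (lam η : ℝ) (T : ℕ)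
    (N : (Fin (2 ^ d) → ℤˣ) → Fin (2 ^ (i + 1)) → ℝ) (V : Signs i k) (W₀ : Weights i k) :
    Weights i k :=
  (fun W : Weights i k => W - η • layerGrad S lam N V W)^[T] W₀

/-- Initial weights of all neurons of the network: the pair `(w, v)` for each neuron `l` of each
neural gate `j` of each level `i`. -/
abbrev Init (d k : ℕ) : Type :=
  (i : Fin d) → Fin (2 ^ (i : ℕ)) → Fin k → (Fin 2 → ℝ) × ℤˣ

/-- The network obtained when the blocks of the levels `d - 1, …, i` have been trained one after
the other, where `r` is the number of these blocks. -/
noncomputable def trainedAux {k m : ℕ} (S : Fin m → Example d) (lam η : ℝ) (T : ℕ)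
    (θ : Init d k) :
    (r i : ℕ) → i + r = d → (Fin (2 ^ d) → ℤˣ) → Fin (2 ^ i) → ℝ
  | 0, i, h => fun x j => toReal (x (Fin.cast (by rw [← h, Nat.add_zero]) j))
  | r + 1, i, h =>
    let N := trainedAux S lam η T θ r (i + 1) (by omega)
    let W₀ : Weights i k := fun j l => (θ ⟨i, by omega⟩ j l).1
    let V : Signs i k := fun j l => (θ ⟨i, by omega⟩ j l).2
    fun x => block (trainLayer S lam η T N V W₀) V (N x)

/-- The function returned by layerwise gradient descent with `T` steps per layer. -/
noncomputable def layerwiseGD {k m : ℕ} (S : Fin m → Example d) (lam η : ℝ) (T : ℕ)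
    (θ : Init d k) (x : Fin (2 ^ d) → ℤˣ) : ℝ :=
  trainedAux S lam η T θ d 0 (Nat.zero_add d) x 0

/-- The law of the initialization: all neurons are independent, the weight vector `w` of each
neuron has the given law, and its sign `v` is uniform on `{±1}` and independent of `w`. -/
noncomputable def initLaw {k : ℕ}
    (ν : (i : Fin d) → Fin (2 ^ (i : ℕ)) → Fin k → Measure (Fin 2 → ℝ)) :
    Measure (Init d k) :=
  Measure.pi fun i => Measure.pi fun j => Measure.pi fun l =>
    (ν i j l).prod (uniformOn (Set.univ : Set ℤˣ))

end TreeCircuit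

namespace TreeCircuit

open MeasureTheory ProbabilityTheory

variable {d : ℕ}

/-! ### Signs -/

/-! While a gate is unsaturated, its output lies strictly between -1 and 1, hence so does the pooled
output, and there the loss is linear in the prediction with slope `lam - y`. A saturated gate
receives no gradient. So training a block splits into independent training of its gates
(`trainLayer_apply`), and a gate sees the data only through the weights `A p`, the empirical mean of
`y - lam` on the examples showing it the pattern `p`.

In `{±1}²` two patterns are equal, opposite or orthogonal. The inner products of the neurons with a
pattern `q` therefore evolve autonomously, driven by `q` and `-q` alone (`gateStep_inner`). On such
a line, suppose each nonzero weight has the sign of a target and is bounded away from 0. Neurons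
with the sign of the target that are active initially stay active and grow at a fixed rate until
saturation, while neurons of the opposite sign stay below a small bound. Once every occurring
pattern is saturated nothing moves any more, and the saturation is on the correct side
(`lineStep_iterate_converges`).

The required sign comes from the choice of `lam`, slightly above the mean label. A node correlated
with `y` biases `y - lam` in a direction that depends on its value; for a node independent of `y`
the bias is always negative (`nodeBias`). Conditional independence passes the bias of a node to
every input pattern of its gate (`patternBias`). So correlated nodes are learned up to a sign and
independent ones become the constant -1. The latter loses nothing, since their influence is 0 and
the gate above ignores them (`targetGate_encode`). Induction over the levels gives
`trainedAux_eq_encode`; the root has correlation 1 and is learned exactly.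

Randomness enters through two events: the empirical pattern weights of the circuit nodes are close
to their expectations (Hoeffding), and every gate has a useful neuron for every pattern. Both events
refer to the circuit and the targets, not to the trained layers, so union bounds over fixed families
suffice although training is adaptive. A plain union bound for the initialization would already use
up all of `δ` when `d = 1`; an inclusion-exclusion term makes room for the sampling error
(`failure_le`). -/

@[simp] theorem toReal_one : toReal 1 = 1 := by simp [toReal]

@[simp] theorem toReal_neg (s : ℤˣ) : toReal (-s) = -toReal s := by simp [toReal]

@[simp] theorem toReal_mul (s t : ℤˣ) : toReal (s * t) = toReal s * toReal t := by simp [toReal]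

theorem toReal_eq_one_or (s : ℤˣ) : toReal s = 1 ∨ toReal s = -1 := by
  rcases Int.units_eq_one_or s with rfl | rfl <;> simp

theorem toReal_mul_self (s : ℤˣ) : toReal s * toReal s = 1 := by
  rcases toReal_eq_one_or s with h | h <;> rw [h] <;> norm_num

@[simp] theorem abs_toReal (s : ℤˣ) : |toReal s| = 1 := by
  rcases toReal_eq_one_or s with h | h <;> rw [h] <;> norm_num

theorem sum_units {M : Type*} [AddCommMonoid M] (g : ℤˣ → M) : ∑ s, g s = g 1 + g (-1) := by
  have : (Finset.univ : Finset ℤˣ) = {1, -1} := by decide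
  rw [this, Finset.sum_pair (by decide)]

theorem sum_units_eq {M : Type*} [AddCommMonoid M] (g : ℤˣ → M) (s : ℤˣ) :
    ∑ t, g t = g s + g (-s) := by
  rw [sum_units]
  rcases Int.units_eq_one_or s with rfl | rfl
  · rfl
  · rw [neg_neg, add_comm]

/-! ### Elementary bounds for the activations -/

theorem relu_nonneg (x : ℝ) : 0 ≤ relu x := le_max_right _ _

theorem le_relu (x : ℝ) : x ≤ relu x := le_max_left _ _

theorem hardTanhDeriv_eq_zero_or (x : ℝ) : hardTanhDeriv x = 0 ∨ hardTanhDeriv x = 1 := by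
  unfold hardTanhDeriv; split_ifs <;> simp

theorem hardTanhDeriv_nonneg (x : ℝ) : 0 ≤ hardTanhDeriv x := by
  rcases hardTanhDeriv_eq_zero_or x with h | h <;> rw [h]; norm_num

theorem hardTanhDeriv_le_one (x : ℝ) : hardTanhDeriv x ≤ 1 := by
  rcases hardTanhDeriv_eq_zero_or x with h | h <;> rw [h]; norm_num

theorem mem_Ioo_of_hardTanhDeriv_ne_zero {x : ℝ} (h : hardTanhDeriv x ≠ 0) : -1 < x ∧ x < 1 := by
  by_contra hx
  exact h (if_neg hx)

theorem hardTanh_eq_toReal {x : ℝ} {s : ℤˣ} (h : 1 ≤ toReal s * x) : hardTanh x = toReal s := by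
  unfold hardTanh
  rcases toReal_eq_one_or s with hs | hs <;> rw [hs] at h ⊢
  · rw [min_eq_right (by linarith), max_eq_left (by norm_num)]
  · exact max_eq_right ((min_le_left _ _).trans (by linarith))

/-! ### Training dynamics of a gate along one direction -/

/-- The pre-activation of a gate at the input `s • q`, where `x l` is the inner product of the
weights of neuron `l` with `q`. -/
noncomputable def linePre {k : ℕ} (v : Fin k → ℤˣ) (x : Fin k → ℝ) (s : ℤˣ) : ℝ :=
  ∑ l, toReal (v l) * relu (toReal s * x l)

/-- One gradient step for the inner products of the weights with a fixed direction. -/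
noncomputable def lineStep {k : ℕ} (c : ℝ) (v : Fin k → ℤˣ) (A : ℤˣ → ℝ) (x : Fin k → ℝ) :
    Fin k → ℝ :=
  fun l => x l + c * (toReal (v l) *
    ∑ s, A s * hardTanhDeriv (linePre v x s) * (reluDeriv (toReal s * x l) * toReal s))

section Line

variable {k : ℕ} {c : ℝ} {v : Fin k → ℤˣ} {A : ℤˣ → ℝ} {x : Fin k → ℝ}

/-- A neuron active on `s • q` is inactive on `-s • q`, so only one term of the sum survives. -/
theorem lineStep_of_pos {s : ℤˣ} {l : Fin k} (h : 0 < toReal s * x l) :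
    toReal s * lineStep c v A x l =
      toReal s * x l + c * (toReal (v l) * (A s * hardTanhDeriv (linePre v x s))) := by
  have h' : ¬ 0 < toReal (-s) * x l := by rw [toReal_neg]; linarith
  unfold lineStep
  rw [sum_units_eq _ s]
  simp only [reluDeriv, if_pos h, if_neg h']
  linear_combination (c * (toReal (v l) * (A s * hardTanhDeriv (linePre v x s)))) *
    toReal_mul_self s

theorem lineStep_of_eq_zero {l : Fin k} (h : x l = 0) : lineStep c v A x l = 0 := by
  simp [lineStep, h, reluDeriv]

/-- Makes saturation an absorbing state. -/
theorem lineStep_eq_self (h : ∀ s, A s = 0 ∨ hardTanhDeriv (linePre v x s) = 0) :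
    lineStep c v A x = x := by
  funext l
  have : ∀ s, A s * hardTanhDeriv (linePre v x s) = 0 := fun s => by
    rcases h s with h | h <;> rw [h] <;> simp
  simp [lineStep, this]

variable {F : ℤˣ → ℤˣ} {α R ρ : ℝ} {s : ℤˣ} {x₀ : Fin k → ℝ}

/-- When its sign agrees with that of `A s`, an active neuron is only pushed further into its active
half-line. -/
theorem lineStep_good (hc : 0 ≤ c) (hA : 0 ≤ toReal (F s) * A s) {l : Fin k} (hv : v l = F s)
    (h : 0 < toReal s * x l) : 0 < toReal s * lineStep c v A x l := by
  rw [lineStep_of_pos h, hv, ← mul_assoc]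
  have := mul_nonneg hc (mul_nonneg hA (hardTanhDeriv_nonneg (linePre v x s)))
  linarith [this, mul_assoc (toReal (F s)) (A s) (hardTanhDeriv (linePre v x s)), mul_assoc c (toReal (F s)) (A s * hardTanhDeriv (linePre v x s))]

/-- If the neuron is active on `s`, its contribution shrinks. If it is active on `-s`, it may cross
zero, but a single step has length at most `2c ≤ R`. At zero the subgradient convention freezes it.
-/
theorem lineStep_bad (hc : 0 ≤ c) (hA : 0 ≤ toReal (F s) * A s) (hA2 : ∀ s, |A s| ≤ 2)
    (hcR : c * 2 ≤ R) {l : Fin k} (hv : v l ≠ F s)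
    (h : toReal s * x l ≤ R) : toReal s * lineStep c v A x l ≤ R := by
  have hvF : v l = -F s := (Int.units_ne_iff_eq_neg).1 hv
  rcases lt_trichotomy (toReal s * x l) 0 with h0 | h0 | h0
  · have h1 : 0 < toReal (-s) * x l := by rw [toReal_neg]; linarith
    have h2 := lineStep_of_pos (c := c) (v := v) (A := A) h1
    have h3 : |toReal (v l) * (A (-s) * hardTanhDeriv (linePre v x (-s)))| ≤ 2 := by
      rw [abs_mul, abs_toReal, one_mul, abs_mul, abs_of_nonneg (hardTanhDeriv_nonneg _)]
      calc _ ≤ 2 * 1 := mul_le_mul (hA2 _) (hardTanhDeriv_le_one _) (hardTanhDeriv_nonneg _)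
            (by norm_num)
        _ = 2 := by norm_num
    have h4 := mul_le_mul_of_nonneg_left (abs_le.1 h3).1 hc
    rw [toReal_neg] at h2
    linarith
  · have hx : x l = 0 := by
      rcases mul_eq_zero.1 h0 with h | h
      · have := toReal_mul_self s
        rw [h] at this
        norm_num at this
      · exact h
    rw [lineStep_of_eq_zero hx, ← hx]
    exact h
  · rw [lineStep_of_pos h0, hvF, toReal_neg]
    have := mul_nonneg hc (mul_nonneg hA (hardTanhDeriv_nonneg (linePre v x s)))
    have e : c * (-toReal (F s) * (A s * hardTanhDeriv (linePre v x s))) =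
      -(c * (toReal (F s) * A s * hardTanhDeriv (linePre v x s))) := by ring
    rw [e]
    linarith

/-- The neurons that point to the input of sign `s` initially and have the sign of its target. -/
noncomputable def goodNeurons (v : Fin k → ℤˣ) (F : ℤˣ → ℤˣ) (x₀ : Fin k → ℝ) (s : ℤˣ) :
    Finset (Fin k) :=
  Finset.univ.filter fun l => v l = F s ∧ 0 < toReal s * x₀ l

/-- The neurons keep the sign pattern that makes them useful, and harmful neurons stay small. -/
def LineInvariant (v : Fin k → ℤˣ) (F : ℤˣ → ℤˣ) (R : ℝ) (x₀ x : Fin k → ℝ) : Prop :=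
  ∀ s l, (l ∈ goodNeurons v F x₀ s → 0 < toReal s * x l) ∧ (v l ≠ F s → toReal s * x l ≤ R)

theorem LineInvariant.init (h : ∀ l, |x₀ l| ≤ R) : LineInvariant v F R x₀ x₀ := by
  intro s l
  refine ⟨fun hl => (Finset.mem_filter.1 hl).2.2, fun _ => ?_⟩
  refine (le_abs_self _).trans ?_
  rw [abs_mul, abs_toReal, one_mul]
  exact h l

theorem LineInvariant.step (hc : 0 ≤ c) (hA : ∀ s, 0 ≤ toReal (F s) * A s)
    (hA2 : ∀ s, |A s| ≤ 2) (hcR : c * 2 ≤ R) (h : LineInvariant v F R x₀ x) :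
    LineInvariant v F R x₀ (lineStep c v A x) := fun s l =>
  ⟨fun hl => lineStep_good hc (hA s) (Finset.mem_filter.1 hl).2.1 ((h s l).1 hl),
    fun hv => lineStep_bad hc (hA s) hA2 hcR hv ((h s l).2 hv)⟩

/-- The total contribution of the good neurons. -/
noncomputable def goodMass (v : Fin k → ℤˣ) (F : ℤˣ → ℤˣ) (x₀ x : Fin k → ℝ) (s : ℤˣ) : ℝ :=
  ∑ l ∈ goodNeurons v F x₀ s, toReal s * x l

theorem LineInvariant.goodMass_nonneg (h : LineInvariant v F R x₀ x) :
    0 ≤ goodMass v F x₀ x s :=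
  Finset.sum_nonneg fun l hl => ((h s l).1 hl).le

/-- Neurons with the sign of the target contribute nonnegatively, and at least the good mass in
total; each other neuron costs at most `R`. -/
theorem LineInvariant.goodMass_sub_le (hR : 0 ≤ R) (h : LineInvariant v F R x₀ x) :
    goodMass v F x₀ x s - k * R ≤ toReal (F s) * linePre v x s := by
  have e : goodMass v F x₀ x s - k * R =
      ∑ l, ((if l ∈ goodNeurons v F x₀ s then toReal s * x l else 0) - R) := by
    rw [Finset.sum_sub_distrib, ← Finset.sum_filter]
    simp [goodMass]
  rw [e, linePre, Finset.mul_sum]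
  refine Finset.sum_le_sum fun l _ => ?_
  by_cases hv : v l = F s
  · rw [hv, ← mul_assoc, toReal_mul_self, one_mul]
    have h1 := relu_nonneg (toReal s * x l)
    have h2 := le_relu (toReal s * x l)
    split_ifs <;> linarith
  · have hl : l ∉ goodNeurons v F x₀ s := fun hl => hv (Finset.mem_filter.1 hl).2.1
    rw [if_neg hl, (Int.units_ne_iff_eq_neg).1 hv, toReal_neg, ← mul_assoc, mul_neg,
      toReal_mul_self]
    have : relu (toReal s * x l) ≤ R := max_le ((h s l).2 hv) hR
    linarith

theorem LineInvariant.goodMass_lineStep (h : LineInvariant v F R x₀ x) :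
    goodMass v F x₀ (lineStep c v A x) s = goodMass v F x₀ x s +
      (goodNeurons v F x₀ s).card * (c * (toReal (F s) * A s * hardTanhDeriv (linePre v x s))) := by
  unfold goodMass
  rw [← nsmul_eq_mul, ← Finset.sum_const, ← Finset.sum_add_distrib]
  refine Finset.sum_congr rfl fun l hl => ?_
  rw [lineStep_of_pos ((h s l).1 hl), (Finset.mem_filter.1 hl).2.1]
  ring

/-- Training along one direction: after sufficiently many steps both inputs `s • q` that occur are
mapped to their targets. -/
theorem lineStep_iterate_converges (hc : 0 < c) (hα : 0 < α)
    (hA : ∀ s, A s = 0 ∨ α ≤ toReal (F s) * A s) (hA2 : ∀ s, |A s| ≤ 2)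
    (hcR : c * 4 ≤ R) (hρ : k * R ≤ ρ) (hρ1 : ρ < 1) (hx₀ : ∀ l, |x₀ l| ≤ R)
    (hgood : ∀ s, (goodNeurons v F x₀ s).Nonempty) {T : ℕ}
    (hT : 2 * (1 + 3 / 2 * ρ) < T * (c * α)) (hs : A s ≠ 0) :
    1 ≤ toReal (F s) * linePre v ((lineStep c v A)^[T] x₀) s := by
  have hR : 0 ≤ R := by linarith
  have hA0 : ∀ s, 0 ≤ toReal (F s) * A s := fun s => by
    rcases hA s with h | h
    · rw [h, mul_zero]
    · linarith
  have hA3 : ∀ s, toReal (F s) * A s ≤ 2 := fun s => by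
    refine (le_abs_self _).trans ?_
    rw [abs_mul, abs_toReal, one_mul]
    exact hA2 s
  set X : ℕ → Fin k → ℝ := fun t => (lineStep c v A)^[t] x₀ with hX
  have hXs : ∀ t, X (t + 1) = lineStep c v A (X t) := fun t =>
    Function.iterate_succ_apply' _ _ _
  have hinv : ∀ t, LineInvariant v F R x₀ (X t) := by
    intro t
    induction t with
    | zero => exact LineInvariant.init hx₀
    | succ t ih => rw [hXs]; exact ih.step hc.le hA0 hA2 (by linarith)
  have hρ0 : 0 ≤ ρ := (mul_nonneg (Nat.cast_nonneg k) hR).trans hρ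
  have hcard : ∀ s, ((goodNeurons v F x₀ s).card : ℝ) ≤ k := fun s => by
    exact_mod_cast (Finset.card_le_univ _).trans_eq (Fintype.card_fin k)
  have hpre : ∀ t s, goodMass v F x₀ (X t) s - ρ ≤ toReal (F s) * linePre v (X t) s :=
    fun t s => by linarith [(hinv t).goodMass_sub_le (s := s) hR]
  -- The mass moves only while the gate is unsaturated, when it is below `1 + ρ`; one step adds at
  -- most `k * (R / 2) ≤ ρ / 2`.
  have hupper : ∀ t s, goodMass v F x₀ (X t) s ≤ 1 + 3 / 2 * ρ := by
    intro t s
    induction t with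
    | zero =>
      have : goodMass v F x₀ (X 0) s ≤ ∑ l ∈ goodNeurons v F x₀ s, R :=
        Finset.sum_le_sum fun l _ => (le_abs_self _).trans (by
          rw [abs_mul, abs_toReal, one_mul]
          exact hx₀ l)
      rw [Finset.sum_const, nsmul_eq_mul] at this
      have := mul_le_mul_of_nonneg_right (hcard s) hR
      linarith
    | succ t ih =>
      rw [hXs, (hinv t).goodMass_lineStep]
      rcases hardTanhDeriv_eq_zero_or (linePre v (X t) s) with h0 | h0
      · rw [h0]; linarith
      · have hlt := mem_Ioo_of_hardTanhDeriv_ne_zero (x := linePre v (X t) s) (by rw [h0]; simp)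
        have h1 : toReal (F s) * linePre v (X t) s < 1 := by
          rcases toReal_eq_one_or (F s) with h | h <;> rw [h] <;> linarith [hlt.1, hlt.2]
        have h2 : ((goodNeurons v F x₀ s).card : ℝ) * (c * (toReal (F s) * A s * 1)) ≤
            k * (R / 2) :=
          mul_le_mul (hcard s) (by
            rw [mul_one]
            linarith [mul_le_mul_of_nonneg_left (hA3 s) hc.le])
            (mul_nonneg hc.le (by rw [mul_one]; exact hA0 s)) (Nat.cast_nonneg k)
        rw [h0]
        linarith [hpre t s]
  have hstep : ∀ t s, goodMass v F x₀ (X t) s ≤ goodMass v F x₀ (X (t + 1)) s := by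
    intro t s
    rw [hXs, (hinv t).goodMass_lineStep]
    have := mul_nonneg (Nat.cast_nonneg (goodNeurons v F x₀ s).card : (0 : ℝ) ≤ _)
      (mul_nonneg hc.le (mul_nonneg (hA0 s) (hardTanhDeriv_nonneg (linePre v (X t) s))))
    linarith
  have hprog : ∀ t s, A s ≠ 0 → hardTanhDeriv (linePre v (X t) s) ≠ 0 →
      goodMass v F x₀ (X t) s + c * α ≤ goodMass v F x₀ (X (t + 1)) s := by
    intro t s hs hD
    have hD1 := (hardTanhDeriv_eq_zero_or _).resolve_left hD
    have hα' := (hA s).resolve_left hs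
    rw [hXs, (hinv t).goodMass_lineStep, hD1, mul_one]
    have h1 : (1 : ℝ) ≤ (goodNeurons v F x₀ s).card := by
      exact_mod_cast Finset.card_pos.2 (hgood s)
    have h2 := mul_le_mul h1 (mul_le_mul_of_nonneg_left hα' hc.le)
      (mul_pos hc hα).le (Nat.cast_nonneg _)
    linarith
  -- Otherwise at least one of the two masses gains `c * α` at each of the `T` steps, and their sum
  -- exceeds twice the upper bound.
  obtain ⟨t, htT, ht⟩ : ∃ t < T, ∀ s, A s = 0 ∨ hardTanhDeriv (linePre v (X t) s) = 0 := by
    by_contra! hcon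
    have key : ∀ t ≤ T, t * (c * α) ≤ ∑ s, goodMass v F x₀ (X t) s := by
      intro t
      induction t with
      | zero =>
        intro _
        rw [Nat.cast_zero, zero_mul]
        exact Finset.sum_nonneg fun s _ => (hinv 0).goodMass_nonneg
      | succ t ih =>
        intro ht
        obtain ⟨s, hs1, hs2⟩ := hcon t ht
        have h1 := ih (by omega)
        have h2 := hprog t s hs1 hs2
        have h3 := hstep t (-s)
        rw [sum_units_eq _ s] at h1 ⊢
        push_cast
        linarith
    have h1 := key T le_rfl
    rw [sum_units] at h1
    linarith [hupper T 1, hupper T (-1)]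
  have hfix : X T = X t := by
    obtain ⟨r, rfl⟩ := Nat.exists_eq_add_of_lt htT
    have : X (t + r + 1) = (lineStep c v A)^[r + 1] (X t) := by
      rw [show t + r + 1 = (r + 1) + t by omega]
      exact Function.iterate_add_apply _ _ _ _
    rw [this]
    exact Function.iterate_fixed (lineStep_eq_self ht) _
  change 1 ≤ toReal (F s) * linePre v (X T) s
  -- The signed pre-activation is at least `-ρ > -1`, so saturation can only be at the target's
  -- side.
  have hD : ¬ (-1 < linePre v (X t) s ∧ linePre v (X t) s < 1) := fun h => by
    have := (ht s).resolve_left hs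
    rw [hardTanhDeriv, if_pos h] at this
    norm_num at this
  have hge := hpre t s
  have hnn := (hinv t).goodMass_nonneg (s := s)
  rw [hfix]
  rcases toReal_eq_one_or (F s) with h | h <;> rw [h] at hge ⊢ <;>
  · by_contra hlt
    exact hD ⟨by linarith, by linarith⟩

end Line

/-! ### Training dynamics of a gate -/

/-- One gradient step for the weights of a single gate, where `A p` is the weight of the input
pattern `p`. -/
noncomputable def gateStep {k : ℕ} (c : ℝ) (v : Fin k → ℤˣ) (A : (Fin 2 → ℤˣ) → ℝ)
    (w : Fin k → Fin 2 → ℝ) : Fin k → Fin 2 → ℝ :=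
  fun l a => w l a + c * (toReal (v l) *
    ∑ p : Fin 2 → ℤˣ, A p * hardTanhDeriv (preActivation w v fun b => toReal (p b)) *
      (reluDeriv (∑ b, w l b * toReal (p b)) * toReal (p a)))

theorem sum_patterns {M : Type*} [AddCommMonoid M] (g : (Fin 2 → ℤˣ) → M) :
    ∑ p, g p = g ![1, 1] + g ![1, -1] + g ![-1, 1] + g ![-1, -1] := by
  have : (Finset.univ : Finset (Fin 2 → ℤˣ)) = {![1, 1], ![1, -1], ![-1, 1], ![-1, -1]} := by
    decide
  rw [this, Finset.sum_insert (by decide), Finset.sum_insert (by decide),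
    Finset.sum_pair (by decide), add_assoc, add_assoc]

theorem pattern_cases (q : Fin 2 → ℤˣ) :
    q = ![1, 1] ∨ q = ![1, -1] ∨ q = ![-1, 1] ∨ q = ![-1, -1] := by
  revert q; decide

/-- Different patterns are opposite or orthogonal. -/
theorem sum_mul_inner_pattern (g : (Fin 2 → ℤˣ) → ℝ) (q : Fin 2 → ℤˣ) :
    ∑ p, g p * ∑ a, toReal (p a) * toReal (q a) =
      2 * ∑ s : ℤˣ, g (fun a => s * q a) * toReal s := by
  have e1 : (fun a => (1 : ℤˣ) * q a) = q := by simp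
  have e2 : (fun a => (-1 : ℤˣ) * q a) = -q := by ext a; simp
  rw [sum_patterns, sum_units, e1, e2]
  have n1 : -![(1 : ℤˣ), 1] = ![-1, -1] := by decide
  have n2 : -![(1 : ℤˣ), -1] = ![-1, 1] := by decide
  have n3 : -![(-1 : ℤˣ), 1] = ![1, -1] := by decide
  have n4 : -![(-1 : ℤˣ), -1] = ![1, 1] := by decide
  rcases pattern_cases q with rfl | rfl | rfl | rfl <;>
    simp only [n1, n2, n3, n4, Fin.sum_univ_two, Matrix.cons_val_zero, Matrix.cons_val_one,
      toReal_neg, toReal_one] <;> ring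

theorem sum_mul_smul_pattern (w : Fin 2 → ℝ) (s : ℤˣ) (q : Fin 2 → ℤˣ) :
    ∑ b, w b * toReal (s * q b) = toReal s * ∑ b, w b * toReal (q b) := by
  rw [Finset.mul_sum]
  exact Finset.sum_congr rfl fun b _ => by rw [toReal_mul]; ring

theorem preActivation_smul_pattern {k : ℕ} (w : Fin k → Fin 2 → ℝ) (v : Fin k → ℤˣ) (s : ℤˣ)
    (q : Fin 2 → ℤˣ) :
    preActivation w v (fun b => toReal (s * q b)) =
      linePre v (fun l => ∑ b, w l b * toReal (q b)) s := by
  simp only [preActivation, linePre, sum_mul_smul_pattern]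

/-- The inner products with a pattern evolve autonomously. -/
theorem gateStep_inner {k : ℕ} (c : ℝ) (v : Fin k → ℤˣ) (A : (Fin 2 → ℤˣ) → ℝ)
    (w : Fin k → Fin 2 → ℝ) (q : Fin 2 → ℤˣ) :
    (fun l => ∑ a, gateStep c v A w l a * toReal (q a)) =
      lineStep (c * 2) v (fun s => A fun a => s * q a) fun l => ∑ a, w l a * toReal (q a) := by
  funext l
  have h := sum_mul_inner_pattern (fun p => A p *
    hardTanhDeriv (preActivation w v fun b => toReal (p b)) *
      reluDeriv (∑ b, w l b * toReal (p b))) q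
  simp only [preActivation_smul_pattern, sum_mul_smul_pattern] at h
  simp only [gateStep, lineStep, add_mul, Finset.sum_add_distrib, add_right_inj]
  calc _ = c * toReal (v l) * ∑ a, ∑ p : Fin 2 → ℤˣ, A p *
        hardTanhDeriv (preActivation w v fun b => toReal (p b)) *
          reluDeriv (∑ b, w l b * toReal (p b)) * (toReal (p a) * toReal (q a)) := by
        rw [Finset.mul_sum]
        refine Finset.sum_congr rfl fun a _ => ?_
        rw [Finset.mul_sum, Finset.mul_sum, Finset.mul_sum, Finset.sum_mul]
        exact Finset.sum_congr rfl fun p _ => by ring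
    _ = _ := by
        rw [Finset.sum_comm]
        simp only [← Finset.mul_sum]
        rw [h]
        have e : ∀ f g : ℤˣ → ℝ, (∀ s, f s = g s) →
            c * toReal (v l) * (2 * ∑ s, f s) = c * 2 * (toReal (v l) * ∑ s, g s) :=
          fun f g hfg => by rw [Finset.sum_congr rfl fun s _ => hfg s]; ring
        exact e _ _ fun s => by ring

theorem gateStep_iterate_inner {k : ℕ} (c : ℝ) (v : Fin k → ℤˣ) (A : (Fin 2 → ℤˣ) → ℝ)
    (w : Fin k → Fin 2 → ℝ) (q : Fin 2 → ℤˣ) (T : ℕ) :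
    (fun l => ∑ a, (gateStep c v A)^[T] w l a * toReal (q a)) =
      (lineStep (c * 2) v fun s => A fun a => s * q a)^[T]
        fun l => ∑ a, w l a * toReal (q a) := by
  have h : Function.Semiconj (fun (w : Fin k → Fin 2 → ℝ) l => ∑ a, w l a * toReal (q a))
      (gateStep c v A) (lineStep (c * 2) v fun s => A fun a => s * q a) :=
    fun w => gateStep_inner c v A w q
  exact (h.iterate_right T).eq w

/-- A gate learns its target on all input patterns that occur. -/
theorem gateStep_iterate_converges {k T : ℕ} {c α R ρ : ℝ} {v : Fin k → ℤˣ}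
    {A : (Fin 2 → ℤˣ) → ℝ} {f : (Fin 2 → ℤˣ) → ℤˣ} {w₀ : Fin k → Fin 2 → ℝ}
    (hc : 0 < c) (hα : 0 < α)
    (hA : ∀ p, A p = 0 ∨ α ≤ toReal (f p) * A p) (hA2 : ∀ p, |A p| ≤ 2)
    (hcR : c * 8 ≤ R) (hρ : k * R ≤ ρ) (hρ1 : ρ < 1) (hw₀ : ∀ l a, |w₀ l a| ≤ R / 2)
    (hgood : ∀ p, ∃ l, v l = f p ∧ 0 < ∑ a, w₀ l a * toReal (p a))
    (hT : 2 * (1 + 3 / 2 * ρ) < T * (c * 2 * α)) {p : Fin 2 → ℤˣ} (hp : A p ≠ 0) :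
    neuralGate ((gateStep c v A)^[T] w₀) v (fun a => toReal (p a)) = toReal (f p) := by
  refine hardTanh_eq_toReal ?_
  have e1 : (fun a => (1 : ℤˣ) * p a) = p := by simp
  -- The line through `p` itself, read at `s = 1`; the factor 2 in the rate is the squared norm of a
  -- pattern.
  have h := lineStep_iterate_converges (c := c * 2) (v := v) (A := fun s => A fun a => s * p a)
    (F := fun s => f fun a => s * p a) (x₀ := fun l => ∑ a, w₀ l a * toReal (p a)) (T := T)
    (s := 1) (R := R) (ρ := ρ) (by linarith) hα (fun s => hA _) (fun s => hA2 _) (by linarith) hρ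
    hρ1 (fun l => ?_) (fun s => ?_) hT (by simpa only [e1] using hp)
  · rw [← gateStep_iterate_inner, ← preActivation_smul_pattern] at h
    simpa only [one_mul] using h
  · rw [Fin.sum_univ_two]
    refine (abs_add_le _ _).trans ?_
    rw [abs_mul, abs_mul, abs_toReal, abs_toReal, mul_one, mul_one]
    linarith [hw₀ l 0, hw₀ l 1]
  · obtain ⟨l, hl1, hl2⟩ := hgood fun a => s * p a
    refine ⟨l, Finset.mem_filter.2 ⟨Finset.mem_univ _, hl1, ?_⟩⟩
    rwa [sum_mul_smul_pattern] at hl2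

/-! ### Gradient descent on a block decouples into the gates -/

theorem hardTanh_mem (x : ℝ) : -1 ≤ hardTanh x ∧ hardTanh x ≤ 1 :=
  ⟨le_max_right _ _, max_le (min_le_right _ _) (by norm_num)⟩

theorem hardTanh_of_mem_Ioo {x : ℝ} (h : -1 < x ∧ x < 1) : hardTanh x = x := by
  rw [hardTanh, min_eq_left h.2.le, max_eq_left h.1.le]

theorem avgPool_lt_one {i : ℕ} {z : Fin (2 ^ i) → ℝ} (h : ∀ j, z j ≤ 1) {j : Fin (2 ^ i)}
    (hj : z j < 1) : avgPool z < 1 := by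
  rw [avgPool, div_lt_one (by positivity)]
  calc ∑ j, z j < ∑ _j : Fin (2 ^ i), (1 : ℝ) :=
        Finset.sum_lt_sum (fun j _ => h j) ⟨j, Finset.mem_univ j, hj⟩
    _ = 2 ^ i := by simp

theorem neg_one_lt_avgPool {i : ℕ} {z : Fin (2 ^ i) → ℝ} (h : ∀ j, -1 ≤ z j) {j : Fin (2 ^ i)}
    (hj : -1 < z j) : -1 < avgPool z := by
  have := avgPool_lt_one (z := fun j => -z j) (fun j => by linarith [h j]) (j := j) (by linarith)
  rw [avgPool, Finset.sum_neg_distrib, neg_div] at this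
  rw [avgPool]
  linarith

theorem lossDeriv_of_mem_Ioo {lam u : ℝ} (h : -1 < u ∧ u < 1) (y : ℤˣ) :
    lossDeriv lam u y = lam - toReal y := by
  have h1 : 0 < 1 - toReal y * u := by
    rcases toReal_eq_one_or y with hy | hy <;> rw [hy] <;> linarith [h.1, h.2]
  rw [lossDeriv, if_pos h1, Real.sign_of_pos (by linarith [h.1])]
  ring

/-- As long as some gate is not saturated, the loss is linear in the pooled output. -/
theorem lossDeriv_mul_hardTanhDeriv {i k : ℕ} (lam : ℝ) (W : Weights i k) (V : Signs i k)
    (z : Fin (2 ^ (i + 1)) → ℝ) (y : ℤˣ) (j : Fin (2 ^ i)) :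
    lossDeriv lam (avgPool (block W V z)) y *
        hardTanhDeriv (preActivation (W j) (V j) (pairAt z j)) =
      (lam - toReal y) * hardTanhDeriv (preActivation (W j) (V j) (pairAt z j)) := by
  by_cases h : hardTanhDeriv (preActivation (W j) (V j) (pairAt z j)) = 0
  · rw [h, mul_zero, mul_zero]
  · have h1 := mem_Ioo_of_hardTanhDeriv_ne_zero h
    have h2 : block W V z j = preActivation (W j) (V j) (pairAt z j) := hardTanh_of_mem_Ioo h1
    have h3 : -1 < avgPool (block W V z) :=
      neg_one_lt_avgPool (fun j => (hardTanh_mem _).1) (j := j) (by rw [h2]; exact h1.1)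
    have h4 : avgPool (block W V z) < 1 :=
      avgPool_lt_one (fun j => (hardTanh_mem _).2) (j := j) (by rw [h2]; exact h1.2)
    rw [lossDeriv_of_mem_Ioo ⟨h3, h4⟩]

/-- The empirical mean of `y - lam` on the examples for which the `j`-th pair of the Boolean
features `z` is the pattern `p`. -/
noncomputable def patternWeight {i m : ℕ} (S : Fin m → Example d) (lam : ℝ)
    (z : Fin m → Fin (2 ^ (i + 1)) → ℤˣ) (j : Fin (2 ^ i)) (p : Fin 2 → ℤˣ) : ℝ :=
  (∑ s, if pairAt (z s) j = p then toReal (S s).2 - lam else 0) / m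

/-- With Boolean inputs the sum over examples can be grouped by the pattern seen at gate `j`, and
the linearized loss removes all dependence on the other gates. -/
theorem gradientStep_apply {i k m : ℕ} (S : Fin m → Example d) (lam η : ℝ)
    {N : (Fin (2 ^ d) → ℤˣ) → Fin (2 ^ (i + 1)) → ℝ} {z : Fin m → Fin (2 ^ (i + 1)) → ℤˣ}
    (hN : ∀ s, N (S s).1 = fun j => toReal (z s j)) (V : Signs i k) (W : Weights i k)
    (j : Fin (2 ^ i)) :
    (W - η • layerGrad S lam N V W) j =
      gateStep (η / 2 ^ i) (V j) (patternWeight S lam z j) (W j) := by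
  funext l a
  have hpair : ∀ s, pairAt (N (S s).1) j = fun b => toReal (pairAt (z s) j b) := fun s => by
    rw [hN]; rfl
  set G : (Fin 2 → ℤˣ) → ℝ := fun p =>
    hardTanhDeriv (preActivation (W j) (V j) fun b => toReal (p b)) *
      (reluDeriv (∑ b, W j l b * toReal (p b)) * toReal (p a)) with hG
  have hgrad : layerGrad S lam N V W j l a =
      (∑ s, (lam - toReal (S s).2) * G (pairAt (z s) j)) * (toReal (V j l) / 2 ^ i / m) := by
    unfold layerGrad
    simp only
    rw [div_eq_mul_inv, Finset.sum_mul, Finset.sum_mul]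
    refine Finset.sum_congr rfl fun s _ => ?_
    rw [← mul_div_assoc, ← mul_assoc, lossDeriv_mul_hardTanhDeriv, hpair]
    simp only [hG]
    ring
  have hsum : ∑ p : Fin 2 → ℤˣ, patternWeight S lam z j p * G p =
      (∑ s, (toReal (S s).2 - lam) * G (pairAt (z s) j)) / m := by
    unfold patternWeight
    simp only [div_mul_eq_mul_div, ← Finset.sum_div, Finset.sum_mul]
    rw [Finset.sum_comm]
    congr 1
    refine Finset.sum_congr rfl fun s _ => ?_
    simp only [ite_mul, zero_mul]
    rw [Finset.sum_ite_eq]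
    simp
  have hneg : ∑ s, (lam - toReal (S s).2) * G (pairAt (z s) j) =
      -∑ s, (toReal (S s).2 - lam) * G (pairAt (z s) j) := by
    rw [← Finset.sum_neg_distrib]
    exact Finset.sum_congr rfl fun s _ => by ring
  simp only [gateStep, Pi.sub_apply, Pi.smul_apply, smul_eq_mul, mul_assoc]
  simp only [hG] at hsum hneg hgrad
  rw [hgrad, hsum, hneg]
  ring

theorem trainLayer_apply {i k m : ℕ} (S : Fin m → Example d) (lam η : ℝ) (T : ℕ)
    {N : (Fin (2 ^ d) → ℤˣ) → Fin (2 ^ (i + 1)) → ℝ} {z : Fin m → Fin (2 ^ (i + 1)) → ℤˣ}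
    (hN : ∀ s, N (S s).1 = fun j => toReal (z s j)) (V : Signs i k) (W₀ : Weights i k)
    (j : Fin (2 ^ i)) :
    trainLayer S lam η T N V W₀ j =
      (gateStep (η / 2 ^ i) (V j) (patternWeight S lam z j))^[T] (W₀ j) := by
  have h : Function.Semiconj (fun W : Weights i k => W j)
      (fun W : Weights i k => W - η • layerGrad S lam N V W)
      (gateStep (η / 2 ^ i) (V j) (patternWeight S lam z j)) :=
    fun W => gradientStep_apply S lam η hN V W j
  exact (h.iterate_right T).eq W₀

theorem abs_patternWeight_le {i m : ℕ} (S : Fin m → Example d) {lam : ℝ} (h0 : 0 ≤ lam)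
    (h1 : lam ≤ 1) (z : Fin m → Fin (2 ^ (i + 1)) → ℤˣ) (j : Fin (2 ^ i)) (p : Fin 2 → ℤˣ) :
    |patternWeight S lam z j p| ≤ 2 := by
  rw [patternWeight, abs_div, Nat.abs_cast]
  refine div_le_of_le_mul₀ (Nat.cast_nonneg m) (by norm_num) ?_
  refine (Finset.abs_sum_le_sum_abs _ _).trans ?_
  have : ∀ s ∈ (Finset.univ : Finset (Fin m)),
      |if pairAt (z s) j = p then toReal (S s).2 - lam else 0| ≤ 2 := fun s _ => by
    split_ifs
    · rcases toReal_eq_one_or (S s).2 with h | h <;> rw [h, abs_le] <;> constructor <;> linarith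
    · rw [abs_zero]; norm_num
  refine (Finset.sum_le_sum this).trans ?_
  simp [mul_comm]

/-! ### Levels of the circuit -/

theorem Circuit.level_eq_levelAux (C : Circuit d) {r i : ℕ} (h : i + r = d) (hi : i ≤ d)
    (x : Fin (2 ^ d) → ℤˣ) : C.level i hi x = C.levelAux x r i h := by
  obtain rfl : r = d - i := by omega
  rfl

theorem Circuit.level_eq_layer (C : Circuit d) (i : Fin d) (x : Fin (2 ^ d) → ℤˣ) :
    C.level i i.isLt.le x = C.layer i (C.level ((i : ℕ) + 1) i.isLt x) := by
  have h : (i : ℕ) + ((d - ((i : ℕ) + 1)) + 1) = d := by omega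
  rw [C.level_eq_levelAux h]
  rfl

theorem Circuit.level_apply (C : Circuit d) (i : Fin d) (j : Fin (2 ^ (i : ℕ)))
    (x : Fin (2 ^ d) → ℤˣ) :
    C.level i i.isLt.le x j = C i j (pairAt (C.level ((i : ℕ) + 1) i.isLt x) j) := by
  rw [C.level_eq_layer]; rfl

/-- The position of input `a` of gate `j`. -/
abbrev child {i : ℕ} (j : Fin (2 ^ i)) : Fin 2 → Fin (2 ^ (i + 1)) := pairAt id j

theorem child_injective {i : ℕ} (j : Fin (2 ^ i)) : Function.Injective (child j) := by
  intro a b h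
  have := congrArg Fin.val h
  simp only [child, pairAt, id] at this
  exact Fin.ext (by omega)

/-- A gate does not depend on an input of zero influence. -/
theorem Circuit.apply_update_of_influence_eq_zero (C : Circuit d) {i : Fin d}
    {j : Fin (2 ^ (i : ℕ))} {a : Fin 2} (h : C.influence i (child j a) = 0) (p : Fin 2 → ℤˣ)
    (t : ℤˣ) : C i j (Function.update p a t) = C i j p := by
  have key : ∀ z, C.layer i z = C.layer i (Function.update z (child j a) (-z (child j a))) := by
    intro z
    by_contra hz
    have h1 : ((Finset.univ.filter fun z : Fin (2 ^ ((i : ℕ) + 1)) → ℤˣ =>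
        C.layer i z ≠ C.layer i (Function.update z (child j a) (-z (child j a)))).card : ℝ) ≠ 0 :=
      Nat.cast_ne_zero.2 (Finset.card_ne_zero.2 ⟨z, Finset.mem_filter.2 ⟨Finset.mem_univ _, hz⟩⟩)
    exact div_ne_zero h1 (Nat.cast_ne_zero.2 Fintype.card_ne_zero) h
  by_cases ht : t = p a
  · rw [ht, Function.update_eq_self]
  · rw [(Int.units_ne_iff_eq_neg).1 ht]
    -- A level vector repeating `p` with period 2, so that gate `j` reads `p`.
    set z : Fin (2 ^ ((i : ℕ) + 1)) → ℤˣ := fun n => p ⟨n % 2, by omega⟩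
    have hz : pairAt z j = p := by
      funext b
      simp only [pairAt, z]
      congr 1
      ext
      simp only
      omega
    have hz' : pairAt (Function.update z (child j a) (-z (child j a))) j =
        Function.update p a (-p a) := by
      funext b
      change Function.update z (child j a) (-pairAt z j a) (child j b) = _
      rw [hz]
      by_cases hb : b = a
      · subst hb; simp
      · rw [Function.update_of_ne (fun h => hb (child_injective j h)), Function.update_of_ne hb]
        exact congrFun hz b
    have := congrFun (key z) j
    unfold Circuit.layer at this
    rw [hz, hz'] at this
    exact this.symm

/-! ### The features learned by the network -/

section Encoding

variable (C : Circuit d) (D : Measure (Example d)) (Δ : ℝ)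

/-- The nodes whose value is learned up to a sign: the input bits and the nodes that are
correlated with the label. -/
def Live (i : ℕ) (hi : i ≤ d) (j : Fin (2 ^ i)) : Prop :=
  i = d ∨ meanLabel D + Δ < |correlation C D i hi j|

open Classical in
/-- The sign up to which the value of a node is learned. -/
noncomputable def nodeSign (i : ℕ) (hi : i ≤ d) (j : Fin (2 ^ i)) : ℤˣ :=
  if i = d ∨ 0 < correlation C D i hi j then 1 else -1

open Classical in
/-- The output of the trained neural gate when the node has value `s`. -/
noncomputable def encode (i : ℕ) (hi : i ≤ d) (j : Fin (2 ^ i)) (s : ℤˣ) : ℤˣ :=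
  if Live C D Δ i hi j then nodeSign C D i hi j * s else -1

/-- The Boolean gate that is learned by a neural gate. -/
noncomputable def targetGate (i : Fin d) (j : Fin (2 ^ (i : ℕ))) (p : Fin 2 → ℤˣ) : ℤˣ :=
  encode C D Δ i i.isLt.le j
    (C i j fun a => nodeSign C D ((i : ℕ) + 1) i.isLt (child j a) * p a)

theorem encode_self (j : Fin (2 ^ d)) (s : ℤˣ) : encode C D Δ d le_rfl j s = s := by
  simp [encode, Live, nodeSign]

variable {C D Δ}

theorem nodeSign_mul_encode {i : ℕ} {hi : i ≤ d} {j : Fin (2 ^ i)} (h : Live C D Δ i hi j)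
    (s : ℤˣ) : nodeSign C D i hi j * encode C D Δ i hi j s = s := by
  rw [encode, if_pos h, ← mul_assoc, Int.units_mul_self, one_mul]

/-- Learned inputs are decoded correctly by their sign. The remaining ones are decoded arbitrarily,
but have zero influence, so replacing coordinates one at a time leaves the gate unchanged. -/
theorem targetGate_encode (hcorr : CorrelationProperty C D Δ) (i : Fin d)
    (j : Fin (2 ^ (i : ℕ))) (p : Fin 2 → ℤˣ) :
    targetGate C D Δ i j (fun a => encode C D Δ ((i : ℕ) + 1) i.isLt (child j a) (p a)) =
      encode C D Δ i i.isLt.le j (C i j p) := by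
  unfold targetGate
  congr 1
  set q : Fin 2 → ℤˣ := fun a => nodeSign C D ((i : ℕ) + 1) i.isLt (child j a) *
    encode C D Δ ((i : ℕ) + 1) i.isLt (child j a) (p a) with hq
  have key : ∀ a (p' : Fin 2 → ℤˣ), p' a = p a → C i j (Function.update p' a (q a)) = C i j p' := by
    intro a p' hp'
    by_cases hl : Live C D Δ ((i : ℕ) + 1) i.isLt (child j a)
    · rw [hq]
      simp only
      rw [nodeSign_mul_encode hl, ← hp', Function.update_eq_self]
    · rcases hcorr i (child j a) with h | h
      · exact C.apply_update_of_influence_eq_zero h.1 _ _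
      · exact absurd (Or.inr h) hl
  have e : q = Function.update (Function.update p 0 (q 0)) 1 (q 1) := by
    funext a
    fin_cases a <;> simp
  rw [e, key 1 _ (by simp), key 0 _ rfl]

end Encoding

instance : MeasurableSingletonClass ℤˣ where
  measurableSet_singleton s :=
    ⟨{(s : ℤ)}, MeasurableSet.of_discrete, by ext t; simp [Units.ext_iff]⟩

/-! ### Finite sums for expectations -/

theorem integral_comp_eq_sum {Ω β : Type*} [Fintype Ω] [MeasurableSpace Ω]
    [MeasurableSingletonClass Ω] [Fintype β] [DecidableEq β] (D : Measure Ω)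
    [IsFiniteMeasure D] (X : Ω → β) (g : β → ℝ) :
    ∫ e, g (X e) ∂D = ∑ b, g b * D.real {e | X e = b} := by
  have h : ∀ b, D.real {e | X e = b} = ∑ e, if X e = b then D.real {e} else 0 := fun b => by
    rw [← Finset.sum_filter, sum_measureReal_singleton]
    simp
  rw [integral_fintype .of_finite]
  simp only [h, Finset.mul_sum, mul_ite, mul_zero]
  rw [Finset.sum_comm]
  refine Finset.sum_congr rfl fun e _ => ?_
  rw [Finset.sum_ite_eq, if_pos (Finset.mem_univ _), smul_eq_mul, mul_comm]

/-- The expectation of a function of a Boolean feature and the label. -/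
theorem integral_feature_label (D : Measure (Example d)) [IsProbabilityMeasure D]
    (Z : Example d → ℤˣ) (g : ℤˣ → ℤˣ → ℝ) :
    ∫ e, g (Z e) e.2 ∂D = ∑ s, ∑ t, g s t * D.real {e | Z e = s ∧ e.2 = t} := by
  have := integral_comp_eq_sum D (fun e => (Z e, e.2)) fun b => g b.1 b.2
  rw [this, Fintype.sum_prod_type]
  simp only [Prod.mk.injEq]

theorem integral_indicator_label (D : Measure (Example d)) [IsProbabilityMeasure D]
    {β : Type*} [DecidableEq β] [Fintype β] (X : Example d → β) (b : β) (lam : ℝ) :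
    ∫ e, (if X e = b then toReal e.2 - lam else 0) ∂D =
      ∑ t, (toReal t - lam) * D.real {e | X e = b ∧ e.2 = t} := by
  have := integral_comp_eq_sum D (fun e => (X e, e.2))
    fun c => if c.1 = b then toReal c.2 - lam else 0
  rw [this, Fintype.sum_prod_type, Finset.sum_comm]
  simp only [Prod.mk.injEq, ite_mul, zero_mul]
  refine Finset.sum_congr rfl fun t _ => ?_
  rw [Finset.sum_ite_eq', if_pos (Finset.mem_univ _)]

theorem sum_joint_label (D : Measure (Example d)) [IsProbabilityMeasure D] {β : Type*}
    [DecidableEq β] [Fintype β] (X : Example d → β) (b : β) :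
    ∑ t, D.real {e | X e = b ∧ e.2 = t} = D.real {e | X e = b} := by
  have h1 := integral_comp_eq_sum D (fun e => (X e, e.2)) fun c => if c.1 = b then 1 else 0
  have h2 := integral_comp_eq_sum D X fun c => if c = b then 1 else 0
  rw [Fintype.sum_prod_type, Finset.sum_comm] at h1
  simp only [ite_mul, one_mul, zero_mul, Finset.sum_ite_eq', Finset.mem_univ, if_true,
    Prod.mk.injEq] at h1 h2
  rw [← h1, ← h2]

/-! ### The bias of the label given the value of a node -/

section Margin

variable {C : Circuit d} {D : Measure (Example d)} [IsProbabilityMeasure D] {Δ : ℝ}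

/-- With `Z` the node value, `μ` the mean label and `c` the correlation, `E[y; Z = s] = (μ + s c) /
2`. This exceeds `μ + Δ / 2` when `s` has the sign of `c`, and is below `-Δ / 2` otherwise. Both are
on the correct side of `lam * P(Z = s)` with the claimed margin. -/
theorem nodeBias_of_live (hμ : 0 ≤ meanLabel D) (hΔ : 0 ≤ Δ) {i : ℕ} (hi : i < d)
    {j : Fin (2 ^ i)} (hl : meanLabel D + Δ < |correlation C D i hi.le j|) (s : ℤˣ) :
    Δ / 4 * D.real {e | C.level i hi.le e.1 j = s} ≤
      toReal (encode C D Δ i hi.le j s) * ∑ t, (toReal t - (meanLabel D + Δ / 4)) *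
        D.real {e | C.level i hi.le e.1 j = s ∧ e.2 = t} := by
  have hlive : Live C D Δ i hi.le j := Or.inr hl
  set Z : Example d → ℤˣ := fun e => C.level i hi.le e.1 j
  have hm : meanLabel D = ∑ s, ∑ t, toReal t * D.real {e | Z e = s ∧ e.2 = t} :=
    integral_feature_label D Z fun _ t => toReal t
  have hc : correlation C D i hi.le j =
      ∑ s, ∑ t, toReal s * toReal t * D.real {e | Z e = s ∧ e.2 = t} :=
    integral_feature_label D Z fun s t => toReal s * toReal t
  have h1 : 1 = ∑ s, ∑ t, 1 * D.real {e | Z e = s ∧ e.2 = t} := by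
    rw [← integral_feature_label D Z fun _ _ => 1]; simp
  have hs := sum_joint_label D Z s
  rw [← hs, encode, if_pos hlive]
  have hns : nodeSign C D i hi.le j = if 0 < correlation C D i hi.le j then 1 else -1 := by
    simp [nodeSign, hi.ne]
  rw [hns]
  set μ := meanLabel D
  set c := correlation C D i hi.le j
  have hnn : ∀ s t, 0 ≤ D.real {e | Z e = s ∧ e.2 = t} := fun s t => measureReal_nonneg
  have n1 := hnn 1 1
  have n2 := hnn 1 (-1)
  have n3 := hnn (-1) 1
  have n4 := hnn (-1) (-1)
  simp only [sum_units, toReal_one, toReal_neg] at hm hc h1 ⊢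
  change Δ / 4 * (D.real {e | Z e = s ∧ e.2 = 1} + D.real {e | Z e = s ∧ e.2 = -1}) ≤ _ *
    ((1 - (μ + Δ / 4)) * D.real {e | Z e = s ∧ e.2 = 1} +
      (-1 - (μ + Δ / 4)) * D.real {e | Z e = s ∧ e.2 = -1})
  set a1 := D.real {e | Z e = 1 ∧ e.2 = 1}
  set a2 := D.real {e | Z e = 1 ∧ e.2 = -1}
  set a3 := D.real {e | Z e = -1 ∧ e.2 = 1}
  set a4 := D.real {e | Z e = -1 ∧ e.2 = -1}
  have p1 := mul_nonneg hμ n1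
  have p2 := mul_nonneg hμ n2
  have p3 := mul_nonneg hμ n3
  have p4 := mul_nonneg hμ n4
  have q1 := mul_nonneg hΔ n1
  have q2 := mul_nonneg hΔ n2
  have q3 := mul_nonneg hΔ n3
  have q4 := mul_nonneg hΔ n4
  have hsum : a1 + a2 + (a3 + a4) = 1 := by linarith
  -- Homogenization: with `μ` and `Δ` written as combinations of their products with the four
  -- masses, the claim becomes linear in these products.
  have r1 : μ = μ * (a1 + a2 + (a3 + a4)) := by rw [hsum, mul_one]
  have r2 : Δ = Δ * (a1 + a2 + (a3 + a4)) := by rw [hsum, mul_one]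
  by_cases hpos : 0 < c
  · rw [abs_of_pos hpos] at hl
    rw [if_pos hpos, one_mul]
    rcases Int.units_eq_one_or s with rfl | rfl <;> simp only [toReal_one, toReal_neg] <;>
      linarith
  · rw [abs_of_nonpos (not_lt.1 hpos)] at hl
    rw [if_neg hpos]
    rcases Int.units_eq_one_or s with rfl | rfl <;>
      simp only [toReal_one, toReal_neg, toReal_mul] <;> linarith

/-- Independence leaves the conditional mean of `y - lam` at exactly `-Δ / 4`, so the learned
constant is -1 and equality holds. -/
theorem nodeBias_of_indep {i : ℕ} (hi : i < d)
    {j : Fin (2 ^ i)} (hl : ¬ meanLabel D + Δ < |correlation C D i hi.le j|)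
    (hind : IndepFun (fun e : Example d => C.level i hi.le e.1 j) (fun e => e.2) D) (s : ℤˣ) :
    Δ / 4 * D.real {e | C.level i hi.le e.1 j = s} ≤
      toReal (encode C D Δ i hi.le j s) * ∑ t, (toReal t - (meanLabel D + Δ / 4)) *
        D.real {e | C.level i hi.le e.1 j = s ∧ e.2 = t} := by
  have hlive : ¬ Live C D Δ i hi.le j := fun h => h.elim hi.ne hl
  have hprod : ∀ t, D.real {e | C.level i hi.le e.1 j = s ∧ e.2 = t} =
      D.real {e | C.level i hi.le e.1 j = s} * D.real {e : Example d | e.2 = t} := fun t => by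
    have := hind.measure_inter_preimage_eq_mul {s} {t} (measurableSet_singleton _)
      (measurableSet_singleton _)
    simp only [Measure.real, ← ENNReal.toReal_mul]
    exact congrArg ENNReal.toReal this
  have hm : meanLabel D = ∑ t, toReal t * D.real {e : Example d | e.2 = t} :=
    integral_comp_eq_sum D (fun e => e.2) toReal
  have h1 : 1 = ∑ t, 1 * D.real {e : Example d | e.2 = t} := by
    rw [← integral_comp_eq_sum D (fun e => e.2) fun _ => 1]; simp
  rw [encode, if_neg hlive]
  simp only [hprod, sum_units, toReal_one, toReal_neg, one_mul] at hm h1 ⊢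
  have : ∀ P a b Δ μ : ℝ, 1 = a + b → μ = a + -1 * b →
      Δ / 4 * P ≤ -1 * ((1 - (μ + Δ / 4)) * (P * a) + (-1 - (μ + Δ / 4)) * (P * b)) := by
    intro P a b Δ μ h1 h2
    obtain rfl : b = 1 - a := by linarith
    subst h2
    apply le_of_eq
    ring
  exact this _ _ _ _ _ h1 (by linarith)

/-- Given the output of a gate the label is equally biased for all its input patterns. -/
theorem patternBias (hcond : CondIndepProperty C D) (i : Fin d) (j : Fin (2 ^ (i : ℕ)))
    (p : Fin 2 → ℤˣ)
    (hnode : Δ / 4 * D.real {e | C.level i i.isLt.le e.1 j = C i j p} ≤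
      toReal (encode C D Δ i i.isLt.le j (C i j p)) *
        ∑ t, (toReal t - (meanLabel D + Δ / 4)) *
          D.real {e | C.level i i.isLt.le e.1 j = C i j p ∧ e.2 = t}) :
    Δ / 4 * D.real {e | pairAt (C.level ((i : ℕ) + 1) i.isLt e.1) j = p} ≤
      toReal (encode C D Δ i i.isLt.le j (C i j p)) *
        ∫ e, (if pairAt (C.level ((i : ℕ) + 1) i.isLt e.1) j = p then
          toReal e.2 - (meanLabel D + Δ / 4) else 0) ∂D := by
  simp only [C.level_apply] at hnode
  set X : Example d → Fin 2 → ℤˣ := fun e => pairAt (C.level ((i : ℕ) + 1) i.isLt e.1) j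
  set s := C i j p with hs
  change Δ / 4 * D.real {e | C i j (X e) = s} ≤ _ * ∑ t, (toReal t - (meanLabel D + Δ / 4)) *
    D.real {e | C i j (X e) = s ∧ e.2 = t} at hnode
  change Δ / 4 * D.real {e | X e = p} ≤
    _ * ∫ e, (if X e = p then toReal e.2 - (meanLabel D + Δ / 4) else 0) ∂D
  rw [integral_indicator_label D X p]
  -- Conditional independence cleared of denominators, which also covers conditioning on a null
  -- event.
  have hjoint : ∀ t, D.real {e | X e = p ∧ e.2 = t} * D.real {e | C i j (X e) = s} =
      D.real {e | X e = p} * D.real {e | C i j (X e) = s ∧ e.2 = t} := by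
    intro t
    by_cases h0 : D {e | C i j (X e) = s} = 0
    · have h2 : D {e | X e = p} = 0 := measure_mono_null (fun e he => by
        simp only [Set.mem_ofPred_eq] at he ⊢
        rw [he]) h0
      simp [Measure.real, h0, h2]
    · have hc := hcond i j s p t
      have hms : MeasurableSet {e | C i j (X e) = s} := .of_discrete
      change cond D {e | C i j (X e) = s} {e | X e = p ∧ e.2 = t} =
        cond D {e | C i j (X e) = s} {e | X e = p} *
          cond D {e | C i j (X e) = s} {e : Example d | e.2 = t} at hc
      rw [cond_apply hms, cond_apply hms, cond_apply hms] at hc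
      have e1 : {e | C i j (X e) = s} ∩ {e | X e = p ∧ e.2 = t} = {e | X e = p ∧ e.2 = t} :=
        Set.inter_eq_right.2 fun e he => by
          simp only [Set.mem_ofPred_eq] at he ⊢
          rw [he.1]
      have e2 : {e | C i j (X e) = s} ∩ {e | X e = p} = {e | X e = p} :=
        Set.inter_eq_right.2 fun e he => by
          simp only [Set.mem_ofPred_eq] at he ⊢
          rw [he]
      have e3 : {e | C i j (X e) = s} ∩ {e : Example d | e.2 = t} =
          {e | C i j (X e) = s ∧ e.2 = t} := rfl
      have hc' := congrArg ENNReal.toReal hc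
      rw [e1, e2, e3] at hc'
      simp only [ENNReal.toReal_mul, ENNReal.toReal_inv] at hc'
      have h0' : (D {e | C i j (X e) = s}).toReal ≠ 0 :=
        ENNReal.toReal_ne_zero.2 ⟨h0, measure_ne_top _ _⟩
      simp only [Measure.real]
      field_simp at hc'
      linarith
  by_cases h0 : D.real {e | C i j (X e) = s} = 0
  · have h2 : D.real {e | X e = p} = 0 := le_antisymm (h0 ▸ measureReal_mono fun e he => by
        simp only [Set.mem_ofPred_eq] at he ⊢
        rw [he]) measureReal_nonneg
    have h3 : ∀ t, D.real {e | X e = p ∧ e.2 = t} = 0 := fun t =>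
      le_antisymm (h2 ▸ measureReal_mono fun e he => he.1) measureReal_nonneg
    simp [h2, h3]
  · have hpos : 0 < D.real {e | C i j (X e) = s} := lt_of_le_of_ne measureReal_nonneg (Ne.symm h0)
    refine le_of_mul_le_mul_right ?_ hpos
    have h4 := mul_le_mul_of_nonneg_right hnode
      (measureReal_nonneg : 0 ≤ D.real {e | X e = p})
    have h5 : (∑ t, (toReal t - (meanLabel D + Δ / 4)) * D.real {e | X e = p ∧ e.2 = t}) *
        D.real {e | C i j (X e) = s} =
        (∑ t, (toReal t - (meanLabel D + Δ / 4)) * D.real {e | C i j (X e) = s ∧ e.2 = t}) *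
        D.real {e | X e = p} := by
      rw [Finset.sum_mul, Finset.sum_mul]
      exact Finset.sum_congr rfl fun t _ => by rw [mul_assoc, hjoint]; ring
    rw [mul_assoc (toReal _), h5, ← mul_assoc]
    linarith

end Margin

/-! ### The output node -/

section Root

variable {C : Circuit d} {D : Measure (Example d)} [IsProbabilityMeasure D] {Δ : ℝ}

theorem abs_correlation_le_one (C : Circuit d) (D : Measure (Example d)) [IsProbabilityMeasure D]
    (i : ℕ) (hi : i ≤ d) (j : Fin (2 ^ i)) : |correlation C D i hi j| ≤ 1 := by
  have := norm_integral_le_of_norm_le_const (μ := D) (C := 1)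
    (f := fun e => toReal (C.level i hi e.1 j) * toReal e.2) (.of_forall fun e => by simp)
  simpa [correlation] using this

/-- A correlation never exceeds 1, so otherwise both inputs of the root have zero influence. Then
the root, and with it the label, is almost surely constant, and its mean is 1 or -1. The bound
yields `lam ≤ 1` and makes the root live. -/
theorem meanLabel_add_lt_one (hd : 1 ≤ d) (hsep : D {e | C.eval e.1 ≠ e.2} = 0)
    (hmean : 0 ≤ meanLabel D ∧ meanLabel D < 1) (hcorr : CorrelationProperty C D Δ) :
    meanLabel D + Δ < 1 := by
  by_contra hge
  have hinf : ∀ a, C.influence ⟨0, hd⟩ (child (0 : Fin (2 ^ 0)) a) = 0 := fun a =>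
    (hcorr ⟨0, hd⟩ (child (0 : Fin (2 ^ 0)) a)).elim (fun h => h.1) fun h =>
      absurd (h.trans_le (abs_correlation_le_one C D _ _ _)) hge
  have hconst : ∀ p, C ⟨0, hd⟩ (0 : Fin (2 ^ 0)) p = C ⟨0, hd⟩ (0 : Fin (2 ^ 0)) 1 := by
    intro p
    have e : (1 : Fin 2 → ℤˣ) = Function.update (Function.update p 0 1) 1 1 := by
      funext a
      fin_cases a <;> simp
    rw [e]
    erw [C.apply_update_of_influence_eq_zero (hinf 1), C.apply_update_of_influence_eq_zero (hinf 0)]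
  have hy : ∀ᵐ e ∂D, toReal e.2 = toReal (C ⟨0, hd⟩ (0 : Fin (2 ^ 0)) 1) := by
    have : ∀ᵐ e ∂D, C.eval e.1 = e.2 := by
      rw [ae_iff]; exact hsep
    filter_upwards [this] with e he
    rw [← he]
    congr 1
    exact (C.level_apply ⟨0, hd⟩ (0 : Fin (2 ^ 0)) e.1).trans (hconst _)
  have hμ : meanLabel D = toReal (C ⟨0, hd⟩ (0 : Fin (2 ^ 0)) 1) := by
    rw [meanLabel, integral_congr_ae hy]
    simp
  rcases toReal_eq_one_or (C ⟨0, hd⟩ (0 : Fin (2 ^ 0)) 1) with h | h <;> rw [h] at hμ <;>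
    linarith [hmean.1, hmean.2]

theorem correlation_root (hsep : D {e | C.eval e.1 ≠ e.2} = 0) (hi : 0 ≤ d) (j : Fin (2 ^ 0)) :
    correlation C D 0 hi j = 1 := by
  have hj : j = 0 := Subsingleton.elim (α := Fin 1) j 0
  have : ∀ᵐ e ∂D, toReal (C.level 0 hi e.1 j) * toReal e.2 = 1 := by
    have : ∀ᵐ e ∂D, C.eval e.1 = e.2 := by
      rw [ae_iff]; exact hsep
    filter_upwards [this] with e he
    rw [← he, hj]
    exact toReal_mul_self _
  rw [correlation, integral_congr_ae this]
  simp

theorem encode_root (hsep : D {e | C.eval e.1 ≠ e.2} = 0)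
    (hΔ : meanLabel D + Δ < 1) (j : Fin (2 ^ 0)) (s : ℤˣ) :
    encode C D Δ 0 (Nat.zero_le d) j s = s := by
  simp [encode, Live, nodeSign, correlation_root hsep, hΔ]

/-- The label is biased towards the learned value of every gate. -/
theorem nodeBias (hsep : D {e | C.eval e.1 ≠ e.2} = 0) (hμ : 0 ≤ meanLabel D)
    (hΔ : 0 ≤ Δ) (hlt : meanLabel D + Δ < 1) (hcorr : CorrelationProperty C D Δ)
    (i : Fin d) (j : Fin (2 ^ (i : ℕ))) (s : ℤˣ) :
    Δ / 4 * D.real {e | C.level i i.isLt.le e.1 j = s} ≤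
      toReal (encode C D Δ i i.isLt.le j s) * ∑ t, (toReal t - (meanLabel D + Δ / 4)) *
        D.real {e | C.level i i.isLt.le e.1 j = s ∧ e.2 = t} := by
  obtain ⟨i, hi⟩ := i
  by_cases hl : meanLabel D + Δ < |correlation C D i hi.le j|
  · exact nodeBias_of_live hμ hΔ hi hl s
  · refine nodeBias_of_indep hi hl ?_ s
    cases i with
    | zero => exact absurd (by rwa [correlation_root hsep, abs_one]) hl
    | succ i => exact ((hcorr ⟨i, by omega⟩ j).resolve_right hl).2

end Root

/-! ### Convergence of the network -/

/-- Recoding the features merges patterns: constant features send several `p` to the same `q`, and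
their weights add up. -/
theorem patternWeight_map {i m : ℕ} (S : Fin m → Example d) (lam : ℝ)
    (z : Fin m → Fin (2 ^ (i + 1)) → ℤˣ) (E : Fin (2 ^ (i + 1)) → ℤˣ → ℤˣ) (j : Fin (2 ^ i))
    (q : Fin 2 → ℤˣ) :
    patternWeight S lam (fun s n => E n (z s n)) j q =
      ∑ p : Fin 2 → ℤˣ, if (fun a => E (child j a) (p a)) = q then patternWeight S lam z j p
        else 0 := by
  have h : ∀ p : Fin 2 → ℤˣ, (if (fun a => E (child j a) (p a)) = q then patternWeight S lam z j p
        else 0) = (∑ s, if pairAt (z s) j = p then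
          (if (fun a => E (child j a) (p a)) = q then toReal (S s).2 - lam else 0) else 0) / m := by
    intro p
    split_ifs <;> simp [patternWeight]
  simp only [h, ← Finset.sum_div]
  rw [Finset.sum_comm, patternWeight]
  congr 1
  refine Finset.sum_congr rfl fun s _ => ?_
  rw [Finset.sum_ite_eq, if_pos (Finset.mem_univ _)]
  rfl

/-- The empirical pattern weights of the nodes of the circuit are close to their expectations. -/
def Concentrated {m : ℕ} (C : Circuit d) (D : Measure (Example d)) (lam t : ℝ)
    (S : Fin m → Example d) : Prop :=
  ∀ (i : Fin d) (j : Fin (2 ^ (i : ℕ))) (p : Fin 2 → ℤˣ),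
    |patternWeight S lam (fun s => C.level ((i : ℕ) + 1) i.isLt (S s).1) j p -
      ∫ e, (if pairAt (C.level ((i : ℕ) + 1) i.isLt e.1) j = p then toReal e.2 - lam else 0) ∂D| ≤ t

/-- Every gate has, for each input pattern, an active neuron with the sign of the target. -/
def WellInitialized {k : ℕ} (f : (i : Fin d) → Fin (2 ^ (i : ℕ)) → (Fin 2 → ℤˣ) → ℤˣ)
    (θ : Init d k) : Prop :=
  ∀ i j p, ∃ l, (θ i j l).2 = f i j p ∧ 0 < ∑ a, (θ i j l).1 a * toReal (p a)

/-- The empirical weights of the learned features have the sign of the target gate. -/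
theorem patternWeight_encode_bound {C : Circuit d} {D : Measure (Example d)} {Δ ε : ℝ} {m : ℕ}
    {S : Fin m → Example d}
    (hΔ : 0 ≤ Δ) (hε : 0 ≤ ε) (hcorr : CorrelationProperty C D Δ) (i : Fin d)
    (j : Fin (2 ^ (i : ℕ))) {lam : ℝ}
    (hw : ∀ p, (D {e | pairAt (C.level ((i : ℕ) + 1) i.isLt e.1) j = p} = 0 ∧
      patternWeight S lam (fun s => C.level ((i : ℕ) + 1) i.isLt (S s).1) j p = 0) ∨
      3 * ε * Δ / 16 ≤ toReal (encode C D Δ i i.isLt.le j (C i j p)) *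
        patternWeight S lam (fun s => C.level ((i : ℕ) + 1) i.isLt (S s).1) j p)
    (q : Fin 2 → ℤˣ) :
    ((∀ p, (fun a => encode C D Δ ((i : ℕ) + 1) i.isLt (child j a) (p a)) = q →
        D {e | pairAt (C.level ((i : ℕ) + 1) i.isLt e.1) j = p} = 0) ∧
      patternWeight S lam (fun s n => encode C D Δ ((i : ℕ) + 1) i.isLt n
        (C.level ((i : ℕ) + 1) i.isLt (S s).1 n)) j q = 0) ∨
    3 * ε * Δ / 16 ≤ toReal (targetGate C D Δ i j q) *
      patternWeight S lam (fun s n => encode C D Δ ((i : ℕ) + 1) i.isLt n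
        (C.level ((i : ℕ) + 1) i.isLt (S s).1 n)) j q := by
  rw [patternWeight_map S lam (fun s => C.level ((i : ℕ) + 1) i.isLt (S s).1)
    (encode C D Δ ((i : ℕ) + 1) i.isLt) j q]
  by_cases h0 : ∀ p, (fun a => encode C D Δ ((i : ℕ) + 1) i.isLt (child j a) (p a)) = q →
        D {e | pairAt (C.level ((i : ℕ) + 1) i.isLt e.1) j = p} = 0 ∧
        patternWeight S lam (fun s => C.level ((i : ℕ) + 1) i.isLt (S s).1) j p = 0
  · refine Or.inl ⟨fun p hp => (h0 p hp).1, Finset.sum_eq_zero fun p _ => ?_⟩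
    split_ifs with hp
    · exact (h0 p hp).2
    · rfl
  · right
    push Not at h0
    obtain ⟨p₀, hp₀, hne⟩ := h0
    have h1 := (hw p₀).resolve_left fun h => hne h.1 h.2
    have hα : 0 ≤ 3 * ε * Δ / 16 := by positivity
    have htarget : ∀ p, (fun a => encode C D Δ ((i : ℕ) + 1) i.isLt (child j a) (p a)) = q →
        targetGate C D Δ i j q = encode C D Δ i i.isLt.le j (C i j p) := by
      rintro p rfl
      exact targetGate_encode hcorr i j p
    rw [Finset.mul_sum]
    -- All patterns merged into `q` share one target, so their weights cannot cancel and a single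
    -- one gives the bound.
    refine le_trans ?_ (Finset.single_le_sum (fun p _ => ?_) (Finset.mem_univ p₀))
    · rw [if_pos hp₀, htarget p₀ hp₀]
      exact h1
    · split_ifs with hp
      · rw [htarget p hp]
        rcases hw p with h | h
        · rw [h.2, mul_zero]
        · exact hα.trans h
      · rw [mul_zero]

section Network

variable {C : Circuit d} {D : Measure (Example d)} [IsProbabilityMeasure D] {Δ ε : ℝ}

/-- The empirical weights of the node patterns have the sign of the target. -/
theorem patternWeight_level_bound {m : ℕ} {S : Fin m → Example d}
    (hbias : ∀ (i : Fin d) (j : Fin (2 ^ (i : ℕ))) (p : Fin 2 → ℤˣ),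
      Δ / 4 * D.real {e | pairAt (C.level ((i : ℕ) + 1) i.isLt e.1) j = p} ≤
      toReal (encode C D Δ i i.isLt.le j (C i j p)) *
        ∫ e, (if pairAt (C.level ((i : ℕ) + 1) i.isLt e.1) j = p then
          toReal e.2 - (meanLabel D + Δ / 4) else 0) ∂D)
    (hΔ : 0 ≤ Δ) (hpat : PatternProperty C D ε) (hS : ∀ s, D {S s} ≠ 0)
    (hconc : Concentrated C D (meanLabel D + Δ / 4) (ε * Δ / 16) S)
    (i : Fin d) (j : Fin (2 ^ (i : ℕ))) (p : Fin 2 → ℤˣ) :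
    (D {e | pairAt (C.level ((i : ℕ) + 1) i.isLt e.1) j = p} = 0 ∧
      patternWeight S (meanLabel D + Δ / 4)
        (fun s => C.level ((i : ℕ) + 1) i.isLt (S s).1) j p = 0) ∨
    3 * ε * Δ / 16 ≤ toReal (encode C D Δ i i.isLt.le j (C i j p)) *
      patternWeight S (meanLabel D + Δ / 4)
        (fun s => C.level ((i : ℕ) + 1) i.isLt (S s).1) j p := by
  by_cases h0 : D {e | pairAt (C.level ((i : ℕ) + 1) i.isLt e.1) j = p} = 0
  · refine Or.inl ⟨h0, ?_⟩
    rw [patternWeight, Finset.sum_eq_zero, zero_div]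
    intro s _
    refine if_neg fun h => hS s (measure_mono_null ?_ h0)
    rw [Set.singleton_subset_iff]
    exact h
  · right
    have hpos : 0 < D.real {e | pairAt (C.level ((i : ℕ) + 1) i.isLt e.1) j = p} :=
      ENNReal.toReal_pos h0 (measure_ne_top _ _)
    have h1 := mul_le_mul_of_nonneg_left (hpat i j p hpos) (by linarith : 0 ≤ Δ / 4)
    have h2 := hbias i j p
    have h3 := abs_le.1 (hconc i j p)
    -- The margin is the bias `ε * Δ / 4` minus the sampling error `ε * Δ / 16`.
    rcases toReal_eq_one_or (encode C D Δ i i.isLt.le j (C i j p)) with h | h <;>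
      rw [h] at h2 ⊢ <;> linarith [h3.1, h3.2]

variable {k m T : ℕ} {η R ρ : ℝ} {S : Fin m → Example d} {θ : Init d k}

/-- All trained blocks compute the features `encode` of the nodes of the circuit. -/
theorem trainedAux_eq_encode (hΔ : 0 < Δ) (hε : 0 < ε) (hη : 0 < η)
    (hμ : 0 ≤ meanLabel D) (hlt : meanLabel D + Δ < 1) (hcorr : CorrelationProperty C D Δ)
    (hw : ∀ (i : Fin d) (j : Fin (2 ^ (i : ℕ))) p,
      (D {e | pairAt (C.level ((i : ℕ) + 1) i.isLt e.1) j = p} = 0 ∧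
      patternWeight S (meanLabel D + Δ / 4)
        (fun s => C.level ((i : ℕ) + 1) i.isLt (S s).1) j p = 0) ∨
      3 * ε * Δ / 16 ≤ toReal (encode C D Δ i i.isLt.le j (C i j p)) *
        patternWeight S (meanLabel D + Δ / 4)
          (fun s => C.level ((i : ℕ) + 1) i.isLt (S s).1) j p)
    (hS : ∀ s, D {S s} ≠ 0)
    (hηR : η * 8 ≤ R) (hρ : k * R ≤ ρ) (hρ1 : ρ < 1)
    (hbound : ∀ i j l a, |(θ i j l).1 a| ≤ R / 2)
    (hgood : WellInitialized (targetGate C D Δ) θ)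
    (hT : 2 * (1 + 3 / 2 * ρ) < T * (η / 2 ^ (d - 1) * 2 * (3 * ε * Δ / 16))) :
    ∀ (r i : ℕ) (h : i + r = d) (e : Example d), D {e} ≠ 0 →
      trainedAux S (meanLabel D + Δ / 4) η T θ r i h e.1 =
        fun j => toReal (encode C D Δ i (by omega) j (C.level i (by omega) e.1 j)) := by
  intro r
  induction r with
  | zero =>
    intro i h e _
    obtain rfl : i = d := by omega
    funext j
    rw [encode_self, C.level_eq_levelAux (r := 0) rfl]
    rfl
  | succ r ih =>
    intro i h e he
    have hi : i < d := by omega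
    funext j
    have hN := ih (i + 1) (by omega)
    change neuralGate (trainLayer S (meanLabel D + Δ / 4) η T
      (trainedAux S (meanLabel D + Δ / 4) η T θ r (i + 1) (by omega))
      (fun j l => (θ ⟨i, hi⟩ j l).2) (fun j l => (θ ⟨i, hi⟩ j l).1) j)
      (fun l => (θ ⟨i, hi⟩ j l).2) (pairAt
        (trainedAux S (meanLabel D + Δ / 4) η T θ r (i + 1) (by omega) e.1) j) = _
    rw [trainLayer_apply S (meanLabel D + Δ / 4) η T
      (fun s => hN (S s) (hS s)), hN e he]
    have hb := patternWeight_encode_bound hΔ.le hε.le hcorr ⟨i, hi⟩ j (hw ⟨i, hi⟩ j)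
    have hle : η / 2 ^ i ≤ η := div_le_self hη.le (one_le_pow₀ (by norm_num))
    have hle' : η / 2 ^ (d - 1) ≤ η / 2 ^ i :=
      div_le_div_of_nonneg_left hη.le (by positivity)
        (pow_le_pow_right₀ (by norm_num) (by omega))
    have hα : 0 < 3 * ε * Δ / 16 := by positivity
    have key := gateStep_iterate_converges (T := T) (c := η / 2 ^ i) (α := 3 * ε * Δ / 16) (R := R)
      (ρ := ρ) (v := fun l => (θ ⟨i, hi⟩ j l).2) (w₀ := fun l => (θ ⟨i, hi⟩ j l).1)
      (f := targetGate C D Δ ⟨i, hi⟩ j) (by positivity) hα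
      (fun q => (hb q).imp_left And.right)
      (fun q => abs_patternWeight_le S (by linarith) (by linarith) _ j q)
      (by linarith) hρ hρ1 (fun l a => hbound ⟨i, hi⟩ j l a) (fun p => hgood ⟨i, hi⟩ j p)
      (hT.trans_le (by gcongr))
      (p := fun a => encode C D Δ (i + 1) hi (child j a) (pairAt (C.level (i + 1) hi e.1) j a)) ?_
    · have h2 := targetGate_encode hcorr ⟨i, hi⟩ j (pairAt (C.level (i + 1) hi e.1) j)
      have h3 := C.level_apply ⟨i, hi⟩ j e.1
      simp only at h2 h3
      rw [h2, ← h3] at key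
      exact key
    -- The encoded pattern of `e` occurs with positive probability because `e` has positive mass, so
    -- its weight cannot vanish.
    · intro h0
      rcases hb (fun a => encode C D Δ (i + 1) hi (child j a)
        (pairAt (C.level (i + 1) hi e.1) j a)) with h | h
      · refine he (measure_mono_null ?_ (h.1 _ rfl))
        rw [Set.singleton_subset_iff]
        rfl
      · rw [h0, mul_zero] at h
        linarith

end Network

/-! ### Concentration of the sample -/

/-- A variable in an interval of length 2 is sub-Gaussian with parameter `(2 / 2) ^ 2 = 1`. -/
theorem measureReal_sum_ge_le {Ω : Type*} [MeasurableSpace Ω]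
    {D : Measure Ω} [IsProbabilityMeasure D] {g : Ω → ℝ} (hg : Measurable g)
    {a b : ℝ} (hab : b - a = 2) (hmem : ∀ x, g x ∈ Set.Icc a b) (m : ℕ) {t : ℝ} (ht : 0 ≤ t) :
    (Measure.pi fun _ : Fin m => D).real {S | m * t ≤ ∑ s, (g (S s) - ∫ x, g x ∂D)} ≤
      Real.exp (-(m * t ^ 2 / 2)) := by
  have hind : iIndepFun (fun (s : Fin m) (S : Fin m → Ω) => g (S s) - ∫ x, g x ∂D)
      (Measure.pi fun _ : Fin m => D) :=
    iIndepFun_pi (X := fun _ x => g x - ∫ x, g x ∂D) fun _ => (hg.sub_const _).aemeasurable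
  have hsub : ∀ s ∈ (Finset.univ : Finset (Fin m)),
      HasSubgaussianMGF (fun S : Fin m → Ω => g (S s) - ∫ x, g x ∂D) 1
        (Measure.pi fun _ : Fin m => D) := by
    intro s _
    have h := hasSubgaussianMGF_of_mem_Icc (μ := Measure.pi fun _ : Fin m => D)
      (X := fun S => g (S s)) (a := a) (b := b)
      (hg.comp (measurable_pi_apply s)).aemeasurable (.of_forall fun S => hmem _)
    rw [integral_comp_eval (μ := fun _ : Fin m => D) (f := g) hg.aestronglyMeasurable, hab] at h
    have e : ((‖(2 : ℝ)‖₊ / 2) ^ 2 : NNReal) = 1 := by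
      ext; simp
    rwa [e] at h
  refine (HasSubgaussianMGF.measure_sum_ge_le_of_iIndepFun hind hsub
    (mul_nonneg (Nat.cast_nonneg m) ht)).trans_eq ?_
  congr 1
  rcases Nat.eq_zero_or_pos m with rfl | hm
  · simp
  · have : (m : ℝ) ≠ 0 := by positivity
    simp only [Finset.sum_const, Finset.card_univ, Fintype.card_fin, nsmul_eq_mul, mul_one,
      NNReal.coe_natCast]
    field_simp

/-- Hoeffding's inequality for the empirical mean of a function with values in an interval of
length two. -/
theorem measureReal_abs_mean_sub_gt_le {Ω : Type*} [MeasurableSpace Ω]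
    {D : Measure Ω} [IsProbabilityMeasure D] {g : Ω → ℝ} (hg : Measurable g)
    {a b : ℝ} (hab : b - a = 2) (hmem : ∀ x, g x ∈ Set.Icc a b) {m : ℕ} (hm : 0 < m) {t : ℝ}
    (ht : 0 ≤ t) :
    (Measure.pi fun _ : Fin m => D).real {S | t < |(∑ s, g (S s)) / m - ∫ x, g x ∂D|} ≤
      2 * Real.exp (-(m * t ^ 2 / 2)) := by
  have h1 := measureReal_sum_ge_le (D := D) hg hab hmem m ht
  have h2 := measureReal_sum_ge_le (D := D) hg.neg (a := -b) (b := -a) (by linarith)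
    (fun x => ⟨by simpa using (hmem x).2, by simpa using (hmem x).1⟩) m ht
  rw [two_mul]
  refine le_trans (le_trans (measureReal_mono ?_) (measureReal_union_le _ _)) (add_le_add h1 h2)
  intro S hS
  have hm' : (0 : ℝ) < m := by exact_mod_cast hm
  have e : (∑ s, g (S s)) / m * m = ∑ s, g (S s) := div_mul_cancel₀ _ hm'.ne'
  simp only [Set.mem_ofPred_eq, Set.mem_union, Pi.neg_apply, integral_neg] at hS ⊢
  simp only [Finset.sum_sub_distrib, Finset.sum_neg_distrib, Finset.sum_const, Finset.card_univ,
    Fintype.card_fin, nsmul_eq_mul]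
  rcases lt_abs.1 hS with h | h
  · left
    have := mul_le_mul_of_nonneg_right h.le hm'.le
    linarith
  · right
    have := mul_le_mul_of_nonneg_right h.le hm'.le
    linarith

/-! ### Initialization -/

section Initialization

theorem uniformOn_real_singleton (s : ℤˣ) :
    (uniformOn (Set.univ : Set ℤˣ)).real {s} = 1 / 2 := by
  rw [Measure.real, uniformOn_univ, Measure.count_singleton]
  simp

/-- The neurons that are active on the pattern `p` and have the sign `s`. -/
def usefulNeurons (p : Fin 2 → ℤˣ) (s : ℤˣ) : Set ((Fin 2 → ℝ) × ℤˣ) :=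
  {w | 0 < ∑ a, w a * toReal (p a)} ×ˢ {s}

theorem measurableSet_usefulNeurons (p : Fin 2 → ℤˣ) (s : ℤˣ) :
    MeasurableSet (usefulNeurons p s) :=
  (measurableSet_lt measurable_const (Finset.measurable_sum _ fun a _ =>
    (measurable_pi_apply a).mul_const _)).prod (measurableSet_singleton s)

theorem usefulNeurons_real {ν : Measure (Fin 2 → ℝ)} {p : Fin 2 → ℤˣ}
    (hfair : ν {w | 0 < ∑ a, w a * toReal (p a)} = 1 / 2) (s : ℤˣ) :
    (ν.prod (uniformOn (Set.univ : Set ℤˣ))).real (usefulNeurons p s) = 1 / 4 := by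
  have := uniformOn_real_singleton s
  rw [Measure.real] at this
  rw [Measure.real, usefulNeurons, Measure.prod_prod, ENNReal.toReal_mul, this, hfair]
  norm_num

/-- The initializations of a gate without useful neuron for the pattern `p`. -/
def gateFailure (k : ℕ) (p : Fin 2 → ℤˣ) (s : ℤˣ) : Set (Fin k → (Fin 2 → ℝ) × ℤˣ) :=
  Set.univ.pi fun _ => (usefulNeurons p s)ᶜ

theorem measurableSet_gateFailure {k : ℕ} (p : Fin 2 → ℤˣ) (s : ℤˣ) :
    MeasurableSet (gateFailure k p s) :=
  MeasurableSet.univ_pi fun _ => (measurableSet_usefulNeurons p s).compl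

variable {k : ℕ} (ν : Fin k → Measure (Fin 2 → ℝ)) [∀ l, IsProbabilityMeasure (ν l)]

/-- The law of the neurons of a single gate. -/
noncomputable abbrev gateLaw : Measure (Fin k → (Fin 2 → ℝ) × ℤˣ) :=
  Measure.pi fun l => (ν l).prod (uniformOn (Set.univ : Set ℤˣ))

variable {ν}

theorem gateFailure_real
    (hfair : ∀ l (p : Fin 2 → ℤˣ), (ν l) {w | 0 < ∑ a, w a * toReal (p a)} = 1 / 2)
    (p : Fin 2 → ℤˣ) (s : ℤˣ) :
    (gateLaw ν).real (gateFailure k p s) = (3 / 4) ^ k := by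
  rw [Measure.real, gateFailure, Measure.pi_pi, ENNReal.toReal_prod]
  have : ∀ l, (((ν l).prod (uniformOn (Set.univ : Set ℤˣ))) (usefulNeurons p s)ᶜ).toReal =
      3 / 4 := fun l => by
    have := probReal_compl_eq_one_sub (μ := (ν l).prod (uniformOn (Set.univ : Set ℤˣ)))
      (measurableSet_usefulNeurons p s)
    rw [usefulNeurons_real (hfair l p)] at this
    rw [← Measure.real, this]
    norm_num
  simp only [this, Finset.prod_const, Finset.card_univ, Fintype.card_fin]

/-- A neuron is useless for both patterns with probability at least `1 - 1/4 - 1/4`. This lower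
bound is what improves on the union bound. -/
theorem gateFailure_inter_real_ge
    (hfair : ∀ l (p : Fin 2 → ℤˣ), (ν l) {w | 0 < ∑ a, w a * toReal (p a)} = 1 / 2)
    (p q : Fin 2 → ℤˣ) (s t : ℤˣ) :
    (1 / 2) ^ k ≤ (gateLaw ν).real (gateFailure k p s ∩ gateFailure k q t) := by
  rw [Measure.real, gateFailure, gateFailure, ← Set.pi_inter_distrib, Measure.pi_pi,
    ENNReal.toReal_prod]
  have : ∀ l, (1 / 2 : ℝ) ≤ (((ν l).prod (uniformOn (Set.univ : Set ℤˣ)))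
      ((usefulNeurons p s)ᶜ ∩ (usefulNeurons q t)ᶜ)).toReal := fun l => by
    have h1 := measureReal_union_le (μ := (ν l).prod (uniformOn (Set.univ : Set ℤˣ)))
      (usefulNeurons p s) (usefulNeurons q t)
    rw [← Set.compl_union, ← Measure.real, probReal_compl_eq_one_sub
      ((measurableSet_usefulNeurons p s).union (measurableSet_usefulNeurons q t))]
    rw [usefulNeurons_real (hfair l p), usefulNeurons_real (hfair l q)] at h1
    linarith
  calc (1 / 2 : ℝ) ^ k = ∏ _l : Fin k, (1 / 2 : ℝ) := by simp
    _ ≤ _ := Finset.prod_le_prod (fun _ _ => by norm_num) fun l _ => this l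

theorem gateFailure_union_real_le
    (hfair : ∀ l (p : Fin 2 → ℤˣ), (ν l) {w | 0 < ∑ a, w a * toReal (p a)} = 1 / 2)
    (p q : Fin 2 → ℤˣ) (s t : ℤˣ) :
    (gateLaw ν).real (gateFailure k p s ∪ gateFailure k q t) ≤
      2 * (3 / 4) ^ k - (1 / 2) ^ k := by
  have h := measureReal_union_add_inter (μ := gateLaw ν) (s := gateFailure k p s)
    (measurableSet_gateFailure q t)
  rw [gateFailure_real hfair, gateFailure_real hfair] at h
  linarith [gateFailure_inter_real_ge hfair p q s t]

/-- The probability that a gate lacks a useful neuron for some pattern. -/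
theorem gateFailure_iUnion_real_le
    (hfair : ∀ l (p : Fin 2 → ℤˣ), (ν l) {w | 0 < ∑ a, w a * toReal (p a)} = 1 / 2)
    (f : (Fin 2 → ℤˣ) → ℤˣ) :
    (gateLaw ν).real (⋃ p, gateFailure k p (f p)) ≤ 4 * (3 / 4) ^ k - 2 * (1 / 2) ^ k := by
  -- The four patterns are split into two pairs, and each pair saves `(1 / 2) ^ k`.
  have h1 := gateFailure_union_real_le hfair ![1, 1] ![1, -1] (f ![1, 1]) (f ![1, -1])
  have h2 := gateFailure_union_real_le hfair ![-1, 1] ![-1, -1] (f ![-1, 1]) (f ![-1, -1])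
  refine le_trans (le_trans (measureReal_mono ?_) (measureReal_union_le
    (gateFailure k ![1, 1] (f ![1, 1]) ∪ gateFailure k ![1, -1] (f ![1, -1]))
    (gateFailure k ![-1, 1] (f ![-1, 1]) ∪ gateFailure k ![-1, -1] (f ![-1, -1])))) (by linarith)
  refine Set.iUnion_subset fun p => ?_
  rcases pattern_cases p with rfl | rfl | rfl | rfl
  · exact Set.subset_union_left.trans Set.subset_union_left
  · exact Set.subset_union_right.trans Set.subset_union_left
  · exact Set.subset_union_left.trans Set.subset_union_right
  · exact Set.subset_union_right.trans Set.subset_union_right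

end Initialization

section InitLaw

variable {k : ℕ} {ν : (i : Fin d) → Fin (2 ^ (i : ℕ)) → Fin k → Measure (Fin 2 → ℝ)}
  [∀ i j l, IsProbabilityMeasure (ν i j l)]

instance : IsProbabilityMeasure (initLaw ν) := by
  unfold initLaw; infer_instance

theorem measurePreserving_initLaw (i : Fin d) (j : Fin (2 ^ (i : ℕ))) :
    MeasurePreserving (fun θ : Init d k => θ i j) (initLaw ν) (gateLaw (ν i j)) :=
  (measurePreserving_eval (fun j => gateLaw (ν i j)) j).comp
    (measurePreserving_eval (fun i => Measure.pi fun j => gateLaw (ν i j)) i)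

theorem ae_initLaw_bound {B : ℝ} (hbound : ∀ i j l, ∀ᵐ w ∂(ν i j l), ∀ a, |w a| ≤ B) :
    ∀ᵐ θ ∂(initLaw ν), ∀ i j l a, |(θ i j l).1 a| ≤ B := by
  simp only [ae_all_iff]
  intro i j l
  have h1 : Measure.QuasiMeasurePreserving (fun θ : Init d k => (θ i j l).1) (initLaw ν)
      (ν i j l) :=
    (Measure.quasiMeasurePreserving_fst.comp
      (Measure.quasiMeasurePreserving_eval
        (fun l => (ν i j l).prod (uniformOn (Set.univ : Set ℤˣ))) l)).comp
      (measurePreserving_initLaw i j).quasiMeasurePreserving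
  simpa only [ae_all_iff] using h1.ae (hbound i j l)

theorem card_gates (d : ℕ) : Fintype.card (Σ i : Fin d, Fin (2 ^ (i : ℕ))) = 2 ^ d - 1 := by
  rw [Fintype.card_sigma]
  simp only [Fintype.card_fin]
  rw [Fin.sum_univ_eq_sum_range (fun i => 2 ^ i) d, Nat.geomSum_eq le_rfl]
  simp

/-- The target `f` is fixed in advance; it will be `targetGate`, which depends on neither the sample
nor the initialization. -/
theorem measureReal_not_wellInitialized_le
    (hfair : ∀ i j l (p : Fin 2 → ℤˣ), (ν i j l) {w | 0 < ∑ a, w a * toReal (p a)} = 1 / 2)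
    (f : (i : Fin d) → Fin (2 ^ (i : ℕ)) → (Fin 2 → ℤˣ) → ℤˣ) :
    (initLaw ν).real {θ | ¬ WellInitialized f θ} ≤
      (2 ^ d - 1 : ℕ) * (4 * (3 / 4) ^ k - 2 * (1 / 2) ^ k) := by
  have hsub : {θ : Init d k | ¬ WellInitialized f θ} ⊆
      ⋃ n : Σ i : Fin d, Fin (2 ^ (i : ℕ)), (fun θ : Init d k => θ n.1 n.2) ⁻¹'
        ⋃ p, gateFailure k p (f n.1 n.2 p) := by
    intro θ hθ
    simp only [WellInitialized, Set.mem_ofPred_eq] at hθ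
    push Not at hθ
    obtain ⟨i, j, p, h⟩ := hθ
    refine Set.mem_iUnion.2 ⟨⟨i, j⟩, Set.mem_iUnion.2 ⟨p, ?_⟩⟩
    rintro l - ⟨h1, h2⟩
    exact absurd h1 (not_lt.2 (h l h2))
  refine (measureReal_mono hsub).trans ((measureReal_iUnion_fintype_le _).trans ?_)
  refine (Finset.sum_le_sum (g := fun _ => 4 * (3 / 4) ^ k - 2 * (1 / 2) ^ k)
    fun n _ => ?_).trans_eq ?_
  · rw [Measure.real, (measurePreserving_initLaw n.1 n.2).measure_preimage
      (MeasurableSet.iUnion fun p => measurableSet_gateFailure p _).nullMeasurableSet]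
    exact gateFailure_iUnion_real_le (hfair n.1 n.2) _
  · rw [Finset.sum_const, Finset.card_univ, card_gates, nsmul_eq_mul]

end InitLaw

/-! ### The sample -/

theorem ae_singleton_ne_zero {Ω : Type*} [Countable Ω] [MeasurableSpace Ω] (D : Measure Ω) :
    ∀ᵐ e ∂D, D {e} ≠ 0 := by
  rw [ae_iff]
  simp only [not_not]
  rw [← Set.biUnion_of_singleton {e | D {e} = 0}, measure_biUnion_null_iff (Set.to_countable _)]
  exact fun e he => he

/-- Discards samples containing null examples, on which the trained features are not controlled. -/
theorem ae_sample_ne_zero {Ω : Type*} [Countable Ω] [MeasurableSpace Ω] (D : Measure Ω)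
    [IsProbabilityMeasure D] (m : ℕ) :
    ∀ᵐ S ∂(Measure.pi fun _ : Fin m => D), ∀ s, D {S s} ≠ 0 :=
  ae_all_iff.2 fun s => (Measure.quasiMeasurePreserving_eval (fun _ : Fin m => D) s).ae
    (ae_singleton_ne_zero D)

/-- Hoeffding for each of the `4 * (2 ^ d - 1)` gate-pattern pairs; `y - lam` or 0 always lies in
`[-1 - lam, 1 - lam]`. -/
theorem measureReal_not_concentrated_le (C : Circuit d) (D : Measure (Example d))
    [IsProbabilityMeasure D] {lam t : ℝ} (h0 : 0 ≤ lam) (h1 : lam ≤ 1) (ht : 0 ≤ t) {m : ℕ}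
    (hm : 0 < m) :
    (Measure.pi fun _ : Fin m => D).real {S | ¬ Concentrated C D lam t S} ≤
      (2 ^ d - 1 : ℕ) * (8 * Real.exp (-(m * t ^ 2 / 2))) := by
  have hsub : {S : Fin m → Example d | ¬ Concentrated C D lam t S} ⊆
      ⋃ n : (Σ i : Fin d, Fin (2 ^ (i : ℕ))) × (Fin 2 → ℤˣ),
        {S | t < |patternWeight S lam
          (fun s => C.level ((n.1.1 : ℕ) + 1) n.1.1.isLt (S s).1) n.1.2 n.2 -
          ∫ e, (if pairAt (C.level ((n.1.1 : ℕ) + 1) n.1.1.isLt e.1) n.1.2 = n.2 then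
            toReal e.2 - lam else 0) ∂D|} := by
    intro S hS
    simp only [Concentrated, Set.mem_ofPred_eq] at hS
    push Not at hS
    obtain ⟨i, j, p, h⟩ := hS
    exact Set.mem_iUnion.2 ⟨⟨⟨i, j⟩, p⟩, h⟩
  refine (measureReal_mono hsub).trans ((measureReal_iUnion_fintype_le _).trans ?_)
  refine (Finset.sum_le_sum (g := fun _ => 2 * Real.exp (-(m * t ^ 2 / 2)))
    fun n _ => ?_).trans_eq ?_
  · refine measureReal_abs_mean_sub_gt_le (D := D) (g := fun e : Example d =>
      if pairAt (C.level ((n.1.1 : ℕ) + 1) n.1.1.isLt e.1) n.1.2 = n.2 then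
        toReal e.2 - lam else 0) (a := -1 - lam) (b := 1 - lam) .of_discrete (by ring)
      (fun e => ?_) hm ht
    split_ifs
    · rcases toReal_eq_one_or e.2 with h | h <;> rw [h] <;> constructor <;> linarith
    · constructor <;> linarith
  · rw [Finset.sum_const, Finset.card_univ, Fintype.card_prod, card_gates, nsmul_eq_mul]
    have : Fintype.card (Fin 2 → ℤˣ) = 4 := by decide
    rw [this]
    push_cast
    ring

/-! ### The failure probability -/

theorem pow_width_le {k : ℕ} {x : ℝ} (hx : 0 < x)
    (hk : (Real.log (4 / 3))⁻¹ * Real.log x ≤ k) : (3 / 4 : ℝ) ^ k ≤ 1 / x := by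
  have hlog : 0 < Real.log (4 / 3) := Real.log_pos (by norm_num)
  rw [inv_mul_le_iff₀ hlog] at hk
  have h1 : x ≤ (4 / 3 : ℝ) ^ k := by
    rw [← Real.log_le_log_iff hx (by positivity), Real.log_pow, mul_comm]
    exact hk
  rw [show (3 / 4 : ℝ) = 1 / (4 / 3) by norm_num, one_div_pow]
  exact one_div_le_one_div_of_le hx h1

theorem exp_sample_le {m : ℕ} {x ε Δ : ℝ} (hx : 0 < x) (hε : 0 < ε) (hΔ : 0 < Δ)
    (hm : 2 ^ 11 / (ε ^ 2 * Δ ^ 2) * Real.log x < m) :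
    Real.exp (-(m * (ε * Δ / 16) ^ 2 / 2)) ≤ (1 / x) ^ 4 := by
  have h1 : 4 * Real.log x ≤ m * (ε * Δ / 16) ^ 2 / 2 := by
    have hpos : 0 < ε ^ 2 * Δ ^ 2 := by positivity
    rw [div_mul_eq_mul_div, div_lt_iff₀ hpos] at hm
    nlinarith
  calc _ ≤ Real.exp (-(4 * Real.log x)) := Real.exp_le_exp.2 (by linarith)
    _ = (1 / x) ^ 4 := by
      rw [show 4 * Real.log x = Real.log (x ^ 4) by rw [Real.log_pow]; norm_num, Real.exp_neg,
        Real.exp_log (by positivity), one_div, inv_pow]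

/-- With `q = (3 / 4) ^ k`, the inequality `27 / 64 ≤ 1 / 2` gives `(1 / 2) ^ k ≥ q ^ 3`. The map `q
↦ 4 q - 2 q ^ 3` increases up to `Q`, so initialization costs at most `4 Q - 2 Q ^ 3`, and the
remaining `2 Q ^ 3` absorbs the sampling term of order `Q ^ 4`. -/
theorem failure_le {k G : ℕ} {Q h : ℝ} (hQ : Q ≤ 1 / 4)
    (hq : (3 / 4 : ℝ) ^ k ≤ Q) (hh : h ≤ (Q / 4) ^ 4) :
    G * (8 * h) + G * (4 * (3 / 4) ^ k - 2 * (1 / 2) ^ k) ≤ G * (4 * Q) := by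
  rw [← mul_add]
  refine mul_le_mul_of_nonneg_left ?_ (Nat.cast_nonneg G)
  have hr : ((3 / 4 : ℝ) ^ k) ^ 3 ≤ (1 / 2) ^ k := by
    rw [← pow_mul, mul_comm, pow_mul]
    exact pow_le_pow_left₀ (by norm_num) (by norm_num) k
  have hq0 : (0 : ℝ) ≤ (3 / 4) ^ k := by positivity
  set q : ℝ := (3 / 4) ^ k
  have hQ0 : 0 ≤ Q := hq0.trans hq
  have h1 : Q ^ 2 + Q * q + q ^ 2 ≤ 2 := by nlinarith
  have h2 : 0 ≤ (Q - q) * (2 - (Q ^ 2 + Q * q + q ^ 2)) :=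
    mul_nonneg (by linarith) (by linarith)
  have h3 : Q ^ 4 ≤ Q ^ 3 := pow_le_pow_of_le_one hQ0 (by linarith) (by norm_num)
  have h4 : 0 ≤ Q ^ 3 := by positivity
  have h5 : (Q / 4) ^ 4 = Q ^ 4 / 256 := by ring
  have h6 : (Q - q) * (Q ^ 2 + Q * q + q ^ 2) = Q ^ 3 - q ^ 3 := by ring
  linarith

theorem num_gates_le {d : ℕ} (hd : 1 ≤ d) : 2 * (2 ^ d - 1) ≤ 2 ^ d * d := by
  rcases Nat.lt_or_ge d 2 with h | h
  · obtain rfl : d = 1 := by omega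
    norm_num
  · calc 2 * (2 ^ d - 1) ≤ 2 ^ d * 2 := by omega
      _ ≤ 2 ^ d * d := Nat.mul_le_mul_left _ h

/-- The number of steps suffices for the convergence of every gate. -/
theorem steps_suffice {d T : ℕ} (hd : 1 ≤ d) {η ε Δ : ℝ} (hη : 0 < η) (hε : 0 < ε) (hΔ : 0 < Δ)
    (hT : 6 * 2 ^ d / (√2 * η * ε * Δ) < T) :
    2 * (1 + 3 / 2 * (1 / (2 * √2))) < T * (η / 2 ^ (d - 1) * 2 * (3 * ε * Δ / 16)) := by
  have hs : 0 < √2 := by positivity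
  have hsq : √2 * √2 = 2 := Real.mul_self_sqrt (by norm_num)
  have hs1 : √2 < 1.415 := by
    rw [Real.sqrt_lt' (by norm_num)]; norm_num
  have hden : 0 < √2 * η * ε * Δ := by positivity
  obtain ⟨d, rfl⟩ : ∃ d', d = d' + 1 := ⟨d - 1, by omega⟩
  rw [div_lt_iff₀ hden, pow_succ] at hT
  simp only [Nat.add_sub_cancel]
  have hp : (0 : ℝ) < 2 ^ d := by positivity
  have e : T * (η / 2 ^ d * 2 * (3 * ε * Δ / 16)) =
      (T * (√2 * η * ε * Δ)) * (3 / (8 * √2 * 2 ^ d)) := by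
    field_simp
    ring
  rw [e]
  have h1 : (6 * (2 ^ d * 2)) * (3 / (8 * √2 * 2 ^ d)) <
      T * (√2 * η * ε * Δ) * (3 / (8 * √2 * 2 ^ d)) := mul_lt_mul_of_pos_right hT (by positivity)
  refine lt_of_le_of_lt ?_ h1
  have e2 : (6 * (2 ^ d * 2)) * (3 / (8 * √2 * 2 ^ d)) = (9 / 2) / √2 := by
    field_simp
    norm_num
  have e3 : 2 * (1 + 3 / 2 * (1 / (2 * √2))) = (2 * √2 + 3 / 2) / √2 := by
    field_simp
  -- What remains is `2 * √2 + 3 / 2 ≤ 9 / 2`, that is `√2 ≤ 3 / 2`.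
  rw [e2, e3]
  exact div_le_div_of_nonneg_right (by linarith) hs.le

/-- Covering the whole space by `A` and the bad events needs only subadditivity, so `A` need not be
measurable. -/
theorem one_sub_le_measureReal_prod {α β : Type*} [MeasurableSpace α] [MeasurableSpace β]
    {μ : Measure α} {ν : Measure β} [IsProbabilityMeasure μ] [IsProbabilityMeasure ν]
    {A : Set (α × β)} {P P' : α → Prop} {Q Q' : β → Prop} (hP : ∀ᵐ a ∂μ, P a)
    (hQ : ∀ᵐ b ∂ν, Q b) (hA : ∀ a b, P a → P' a → Q b → Q' b → (a, b) ∈ A) :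
    1 - (μ.real {a | ¬ P' a} + ν.real {b | ¬ Q' b}) ≤ (μ.prod ν).real A := by
  have hP0 : μ.real {a | ¬ P a} = 0 := by rw [Measure.real, ae_iff.1 hP, ENNReal.toReal_zero]
  have hQ0 : ν.real {b | ¬ Q b} = 0 := by rw [Measure.real, ae_iff.1 hQ, ENNReal.toReal_zero]
  have hsub : (Set.univ : Set (α × β)) ⊆ A ∪ (({a | ¬ P a} ∪ {a | ¬ P' a}) ×ˢ Set.univ ∪
      Set.univ ×ˢ ({b | ¬ Q b} ∪ {b | ¬ Q' b})) := by
    rintro ⟨a, b⟩ -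
    by_contra h
    simp only [Set.mem_union, Set.mem_prod, Set.mem_ofPred_eq, Set.mem_univ, and_true, true_and,
      not_or, not_not] at h
    exact h.1 (hA a b h.2.1.1 h.2.1.2 h.2.2.1 h.2.2.2)
  have h1 := (measureReal_mono (μ := μ.prod ν) hsub).trans (measureReal_union_le _ _)
  have h2 := measureReal_union_le (μ := μ.prod ν)
    (({a | ¬ P a} ∪ {a | ¬ P' a}) ×ˢ (Set.univ : Set β))
    ((Set.univ : Set α) ×ˢ ({b | ¬ Q b} ∪ {b | ¬ Q' b}))
  rw [measureReal_prod_prod, measureReal_prod_prod, probReal_univ, probReal_univ] at h2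
  rw [probReal_univ] at h1
  have h3 := measureReal_union_le (μ := μ) {a | ¬ P a} {a | ¬ P' a}
  have h4 := measureReal_union_le (μ := ν) {b | ¬ Q b} {b | ¬ Q' b}
  linarith

end TreeCircuit

/-! ### Assembly of the main theorem -/

open TreeCircuit MeasureTheory

theorem mainTheorem1
    (d k m T : ℕ) (hd : 1 ≤ d)
    (δ Δ ε η : ℝ)
    (hδ : 0 < δ ∧ δ < 1 / 2) (hΔ : 0 < Δ ∧ Δ < 1 / 2) (hε : 0 < ε ∧ ε < 1 / 2)
    -- width and learning rate
    (hk : (Real.log (4 / 3))⁻¹ * Real.log (2 * 2 ^ d * d / δ) ≤ k)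
    (hη : 0 < η ∧ η ≤ 1 / (16 * √2 * k))
    -- the circuit and the distribution
    (C : TreeCircuit.Circuit d)
    (D : MeasureTheory.Measure (TreeCircuit.Example d)) [MeasureTheory.IsProbabilityMeasure D]
    (hsep : D {e | C.eval e.1 ≠ e.2} = 0)
    (hmean : 0 ≤ TreeCircuit.meanLabel D ∧ TreeCircuit.meanLabel D < 1)
    (hcorr : TreeCircuit.CorrelationProperty C D Δ)
    (hcond : TreeCircuit.CondIndepProperty C D)
    (hpat : TreeCircuit.PatternProperty C D ε)
    -- sample size and number of steps per layer
    (hm : 2 ^ 11 / (ε ^ 2 * Δ ^ 2) * Real.log (8 * 2 ^ d * d / δ) < m)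
    (hT : 6 * 2 ^ d / (√2 * η * ε * Δ) < T)
    -- laws of the initial weight vectors of the neurons
    (ν : (i : Fin d) → Fin (2 ^ (i : ℕ)) → Fin k → MeasureTheory.Measure (Fin 2 → ℝ))
    [∀ i j l, MeasureTheory.IsProbabilityMeasure (ν i j l)]
    (hbound : ∀ i j l, ∀ᵐ w ∂(ν i j l), ∀ a, |w a| ≤ 1 / (4 * √2 * k))
    (hfair : ∀ i j l (p : Fin 2 → ℤˣ),
      (ν i j l) {w | 0 < ∑ a, w a * TreeCircuit.toReal (p a)} = 1 / 2) :
    -- with probability at least `1 - δ` over the sample and the initialization, zero error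
    1 - δ ≤
      ((MeasureTheory.Measure.pi fun _ : Fin m => D).prod (TreeCircuit.initLaw ν)).real
        {ω | D {e | TreeCircuit.layerwiseGD ω.1 (TreeCircuit.meanLabel D + Δ / 4) η T ω.2 e.1 ≠
          TreeCircuit.toReal e.2} = 0} := by
  have hlt := meanLabel_add_lt_one (Δ := Δ) hd hsep hmean hcorr
  have hd' : (1 : ℝ) ≤ d := by exact_mod_cast hd
  have hpow : (2 : ℝ) ≤ 2 ^ d := by
    calc (2 : ℝ) = 2 ^ 1 := by norm_num
      _ ≤ 2 ^ d := pow_le_pow_right₀ (by norm_num) hd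
  have hnd : (2 : ℝ) ≤ 2 ^ d * d := by nlinarith
  have hδ0 := hδ.1
  have hs : 0 < √2 := by positivity
  have hx : 1 < 2 * 2 ^ d * d / δ := by
    rw [lt_div_iff₀ hδ0]; nlinarith [hδ.2]
  have hk0 : (0 : ℝ) < k := lt_of_lt_of_le
    (mul_pos (inv_pos.2 (Real.log_pos (by norm_num))) (Real.log_pos hx)) hk
  have hx8 : 1 < 8 * 2 ^ d * d / δ := by
    rw [lt_div_iff₀ hδ0]; nlinarith [hδ.2]
  have hm0 : 0 < m := by
    have hΔ0 := hΔ.1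
    have hε0 := hε.1
    have : (0 : ℝ) < m := lt_of_le_of_lt
      (mul_nonneg (by positivity) (Real.log_pos hx8).le) hm
    exact_mod_cast this
  have hlam0 : 0 ≤ meanLabel D + Δ / 4 := by linarith [hmean.1, hΔ.1]
  have hlam1 : meanLabel D + Δ / 4 ≤ 1 := by linarith [hΔ.1]
  have hεΔ : 0 ≤ ε * Δ / 16 := by
    have := mul_pos hε.1 hΔ.1
    linarith
  have hsample := measureReal_not_concentrated_le C D hlam0 hlam1 hεΔ hm0
  have hinit := measureReal_not_wellInitialized_le hfair (targetGate C D Δ)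
  have hQ : 1 / (2 * 2 ^ d * d / δ) ≤ (1 / 4 : ℝ) := by
    rw [one_div_div, div_le_iff₀ (by positivity)]
    linarith [hδ.2]
  -- Here `Q = δ / (2 n d)`, and the logarithm in the sample size has argument `8 n d / δ = 4 / Q`.
  have hfail := failure_le (G := 2 ^ d - 1) hQ (pow_width_le (by linarith) hk)
    ((exp_sample_le (by linarith) hε.1 hΔ.1 hm).trans_eq (by
      congr 1
      field_simp
      norm_num))
  have hG : ((2 ^ d - 1 : ℕ) : ℝ) * (4 * (1 / (2 * 2 ^ d * d / δ))) ≤ δ := by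
    have h1 : (2 : ℝ) * ((2 ^ d - 1 : ℕ) : ℝ) ≤ 2 ^ d * d := by
      exact_mod_cast num_gates_le hd
    rw [one_div_div, ← mul_div_assoc, ← mul_div_assoc, div_le_iff₀ (by positivity)]
    nlinarith
  refine le_trans ?_ (one_sub_le_measureReal_prod (ae_sample_ne_zero D m)
    (P' := Concentrated C D (meanLabel D + Δ / 4) (ε * Δ / 16))
    (Q' := WellInitialized (targetGate C D Δ)) (ae_initLaw_bound hbound) ?_)
  · linarith
  intro S θ hS hconc hθ hgood
  have hbias := fun i j p => patternBias hcond i j p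
    (nodeBias hsep hmean.1 hΔ.1.le hlt hcorr i j (C i j p))
  -- `R` is twice the initial weight bound, since an inner product with a pattern adds two weights;
  -- `ρ = k * R`.
  have hnet := trainedAux_eq_encode (R := 1 / (2 * √2 * k)) (ρ := 1 / (2 * √2)) (T := T)
    hΔ.1 hε.1 hη.1 hmean.1 hlt hcorr
    (patternWeight_level_bound hbias hΔ.1.le hpat hS hconc) hS
    (by
      refine (mul_le_mul_of_nonneg_right hη.2 (by norm_num)).trans_eq ?_
      field_simp
      norm_num)
    (le_of_eq (by field_simp))
    (by
      rw [div_lt_one (by positivity)]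
      have : (1 : ℝ) < √2 := by
        rw [Real.lt_sqrt (by norm_num)]; norm_num
      linarith)
    (fun i j l a => (hθ i j l a).trans_eq (by
      field_simp
      norm_num))
    hgood (steps_suffice hd hη.1 hε.1 hΔ.1 hT) d 0 (Nat.zero_add d)
  have hae : ∀ᵐ e ∂D, layerwiseGD S (meanLabel D + Δ / 4) η T θ e.1 = toReal e.2 := by
    have h1 : ∀ᵐ e ∂D, C.eval e.1 = e.2 := by
      rw [ae_iff]; exact hsep
    filter_upwards [h1, ae_singleton_ne_zero D] with e he1 he2
    rw [layerwiseGD, hnet e he2, ← he1]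
    exact congrArg toReal (encode_root hsep hlt _ _)
  exact ae_iff.1 hae
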